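/- A \emph{skew Boolean algebra with intersections} is an algebra $(A,0,\land,\lor,\setminus,\cap)$ such that: $\land$ and $\lor$ are idempotent and associative and satisfy $x\land(x\lor y)=x=(y\lor x)\land x$ and $x\lor(x\land y)=x=(y\land x)\lor x$; meet distributes over join on both sides, $x\land(y\lor z)=(x\land y)\lor(x\land z)$ and $(y\lor z)\land x=(y\land x)\lor(z\land x)$; $0$ is neutral for $\lor$; $(x\setminus y)\land(x\land y\land x)=0$ and $(x\setminus y)\lor(x\land y\land x)=x$; and $x\cap y$ is the greatest lower bound of $x$ and $y$ for the natural partial order ($x\le y$ iff $x\land y=y\land x=x$). Homomorphisms preserve $0,\land,\lor,\setminus,\cap$. A \emph{Boolean space} is a locally compact Hausdorff space whose clopen sets form a base. A \emph{rectangular skew Boolean space} $(p:E\to B,\curlywedge)$ is a surjective local homeomorphism $p:E\to B$ between Boolean spaces together with a continuous map $\curlywedge:E\times_B E\to E$ over $B$ that makes every fiber $E_x=p^{-1}(x)$ a rectangular band, that is, $\curlywedge$ is idempotent and associative on $E_x$ and satisfies $u\curlywedge v\curlywedge w=u\curlywedge w$. A morphism from $(p:E\to B,\curlywedge)$ to $(p':E'\to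 B',\curlywedge')$ is a pair $(g,h)$ of continuous partial maps $g:E\rightharpoonup E'$ and $h:B\rightharpoonup B'$ with open domains, which are proper (inverse images of compact sets are compact), such that \begin{itemize} \item $p(\operatorname{dom} g)\subseteq\operatorname{dom} h$ and $p'(g(e))=h(p(e))$ for all $e\in\operatorname{dom} g$; \item for every $x\in\operatorname{dom} h$, $g$ maps $E_x\cap\operatorname{dom} g$ bijectively onto $E'_{h(x)}$; \item if $e_1,e_2\in\operatorname{dom} g$ and $p(e_1)=p(e_2)$, then $e_1\curlywedge e_2\in\operatorname{dom} g$ and $g(e_1\curlywedge e_2)=g(e_1)\curlywedge' g(e_2)$. \end{itemize} Morphisms are composed as pairs of partial maps. \textbf{Theorem.} The category of all skew Boolean algebras with intersections (not only the right-handed ones) and their homomorphisms is dual to the category of rectangular skew Boolean spaces: there is an equivalence between the opposite of the former category and the latter. -/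

import Mathlib

open CategoryTheory TopologicalSpace

universe u v

namespace SkewDuality

/-! ## Skew Boolean algebras with intersections -/

/-- A skew Boolean algebra with intersections (a "skew algebra" for short): a meet-distributive
skew lattice `(A, ⊓, ⊔)` with a zero `0`, a relative complement `\`, and an operation `∩` giving
the greatest lower bound with respect to the natural partial order
`x ≤ y ↔ x ⊓ y = x ∧ y ⊓ x = x`. Neither `⊓` nor `⊔` is assumed commutative. -/
class SkewAlgebra (A : Type u) extends Min A, Max A, SDiff A, Inter A, Zero A where
  inf_idem (x : A) : x ⊓ x = x
  sup_idem (x : A) : x ⊔ x = x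
  inf_assoc (x y z : A) : (x ⊓ y) ⊓ z = x ⊓ (y ⊓ z)
  sup_assoc (x y z : A) : (x ⊔ y) ⊔ z = x ⊔ (y ⊔ z)
  inf_sup_absorb (x y : A) : x ⊓ (x ⊔ y) = x
  sup_inf_absorb_right (x y : A) : (y ⊔ x) ⊓ x = x
  sup_inf_absorb (x y : A) : x ⊔ (x ⊓ y) = x
  inf_sup_absorb_right (x y : A) : (y ⊓ x) ⊔ x = x
  inf_sup_distrib_left (x y z : A) : x ⊓ (y ⊔ z) = (x ⊓ y) ⊔ (x ⊓ z)
  inf_sup_distrib_right (x y z : A) : (y ⊔ z) ⊓ x = (y ⊓ x) ⊔ (z ⊓ x)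
  zero_sup (x : A) : 0 ⊔ x = x
  sup_zero (x : A) : x ⊔ 0 = x
  sdiff_inf (x y : A) : (x \ y) ⊓ (x ⊓ y ⊓ x) = 0
  sdiff_sup (x y : A) : (x \ y) ⊔ (x ⊓ y ⊓ x) = x
  inter_le_left (x y : A) : (x ∩ y) ⊓ x = x ∩ y ∧ x ⊓ (x ∩ y) = x ∩ y
  inter_le_right (x y : A) : (x ∩ y) ⊓ y = x ∩ y ∧ y ⊓ (x ∩ y) = x ∩ y
  le_inter (x y z : A) : (z ⊓ x = z ∧ x ⊓ z = z) → (z ⊓ y = z ∧ y ⊓ z = z) →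
    (z ⊓ (x ∩ y) = z ∧ (x ∩ y) ⊓ z = z)

/-- Homomorphisms of skew algebras preserve `0`, meet, join, relative complement and
intersection. -/
@[ext]
structure SkewAlgebraHom (A : Type u) (B : Type v) [SkewAlgebra A] [SkewAlgebra B] where
  toFun : A → B
  map_zero : toFun 0 = 0
  map_inf (x y : A) : toFun (x ⊓ y) = toFun x ⊓ toFun y
  map_sup (x y : A) : toFun (x ⊔ y) = toFun x ⊔ toFun y
  map_sdiff (x y : A) : toFun (x \ y) = toFun x \ toFun y
  map_inter (x y : A) : toFun (x ∩ y) = toFun x ∩ toFun y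

/-- The identity homomorphism. -/
def SkewAlgebraHom.id (A : Type u) [SkewAlgebra A] : SkewAlgebraHom A A where
  toFun := fun x => x
  map_zero := rfl
  map_inf _ _ := rfl
  map_sup _ _ := rfl
  map_sdiff _ _ := rfl
  map_inter _ _ := rfl

/-- `f.comp g` is `g` followed by `f`. -/
def SkewAlgebraHom.comp {A B C : Type u} [SkewAlgebra A] [SkewAlgebra B] [SkewAlgebra C]
    (f : SkewAlgebraHom B C) (g : SkewAlgebraHom A B) : SkewAlgebraHom A C where
  toFun := fun x => f.toFun (g.toFun x)
  map_zero := by rw [g.map_zero, f.map_zero]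
  map_inf x y := by rw [g.map_inf, f.map_inf]
  map_sup x y := by rw [g.map_sup, f.map_sup]
  map_sdiff x y := by rw [g.map_sdiff, f.map_sdiff]
  map_inter x y := by rw [g.map_inter, f.map_inter]

/-- Bundled skew Boolean algebras with intersections. -/
structure SkewAlg : Type (u + 1) where
  carrier : Type u
  [str : SkewAlgebra carrier]

attribute [instance] SkewAlg.str

/-- The category of skew Boolean algebras with intersections and their homomorphisms. -/
instance : Category.{u} SkewAlg.{u} where
  Hom A B := SkewAlgebraHom A.carrier B.carrier
  id A := SkewAlgebraHom.id A.carrier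
  comp f g := g.comp f

/-! ## Partial maps -/

section PartialMaps

variable {X Y : Type u} [TopologicalSpace X] [TopologicalSpace Y]

/-- Mathlib's `PContinuous` for a partial map says exactly that the domain of definition is open
and that the map is continuous on its domain with the induced topology. -/
theorem pcontinuous_iff (f : X →. Y) :
    PContinuous f ↔ IsOpen f.Dom ∧ Continuous f.asSubtype := by
  constructor
  · intro hf
    refine ⟨open_dom_of_pcontinuous hf, ⟨fun s hs => ?_⟩⟩
    rw [PFun.preimage_asSubtype]
    exact (hf s hs).preimage continuous_subtype_val
  · rintro ⟨hd, hc⟩ s hs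
    have h := hd.isOpenMap_subtype_val _ (hs.preimage hc)
    rw [PFun.preimage_asSubtype, Subtype.image_preimage_coe,
      Set.inter_eq_self_of_subset_right (PFun.preimage_subset_dom f s)] at h
    exact h

/-- A proper continuous partial map with open domain of definition: inverse images of compact sets
are compact. -/
structure IsProperPartial (f : X →. Y) : Prop where
  pcontinuous : PContinuous f
  isCompact_preimage (K : Set Y) : IsCompact K → IsCompact (f.preimage K)

theorem IsProperPartial.id : IsProperPartial (PFun.id X) := by
  refine ⟨fun s hs => ?_, fun K hK => ?_⟩
  · rw [← PFun.coe_id, PFun.coe_preimage]; exact hs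
  · rw [← PFun.coe_id, PFun.coe_preimage]; exact hK

theorem IsProperPartial.comp {Z : Type u} [TopologicalSpace Z] {f : Y →. Z} {g : X →. Y}
    (hf : IsProperPartial f) (hg : IsProperPartial g) : IsProperPartial (f.comp g) := by
  refine ⟨fun s hs => ?_, fun K hK => ?_⟩
  · rw [PFun.preimage_comp]; exact hg.pcontinuous _ (hf.pcontinuous s hs)
  · rw [PFun.preimage_comp]; exact hg.isCompact_preimage _ (hf.isCompact_preimage K hK)

end PartialMaps

theorem mem_pfun_id {X : Type u} {x y : X} : y ∈ PFun.id X x ↔ y = x := by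
  rw [PFun.id_apply, Part.mem_some_iff]

theorem mem_pfun_comp {X Y Z : Type u} {f : Y →. Z} {g : X →. Y} {x : X} {z : Z} :
    z ∈ f.comp g x ↔ ∃ y, y ∈ g x ∧ z ∈ f y :=
  Part.mem_bind_iff

/-! ## Rectangular skew Boolean spaces -/

/-- A Boolean space: a locally compact Hausdorff space that is zero-dimensional, i.e. whose clopen
sets form a base of the topology. -/
class BooleanSpace (X : Type u) [TopologicalSpace X] : Prop where
  t2 : T2Space X
  locallyCompact : LocallyCompactSpace X
  clopen_basis : IsTopologicalBasis {s : Set X | IsClopen s}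

/-- A skew Boolean space: a surjective étale map (local homeomorphism) `p : E → B` between Boolean
spaces. -/
structure SkewBooleanSpace : Type (u + 1) where
  E : Type u
  B : Type u
  [topE : TopologicalSpace E]
  [topB : TopologicalSpace B]
  [booleanE : BooleanSpace E]
  [booleanB : BooleanSpace B]
  p : E → B
  etale : IsLocalHomeomorph p
  surj : Function.Surjective p

attribute [instance] SkewBooleanSpace.topE SkewBooleanSpace.topB SkewBooleanSpace.booleanE
  SkewBooleanSpace.booleanB

/-- A morphism `(g, h)` of skew Boolean spaces from `p : E → B` to `p' : E' → B'`: proper continuous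
partial maps `g` from `E` to `E'` and `h` from `B` to `B'`, with open domains of definition, such
that `p` maps the domain of `g` to the domain of `h` with `p' ∘ g = h ∘ p` on the domain of `g`,
and such that `g` maps `E_x ∩ dom g` bijectively onto `E'_{h x}` for all `x` in the domain
of `h`. -/
@[ext]
structure SkewBooleanSpace.Hom (X Y : SkewBooleanSpace.{u}) where
  g : X.E →. Y.E
  h : X.B →. Y.B
  proper_g : IsProperPartial g
  proper_h : IsProperPartial h
  comm (e : X.E) (e' : Y.E) : e' ∈ g e → Y.p e' ∈ h (X.p e)
  bijective_on_fibers (x : X.B) (x' : Y.B) : x' ∈ h x →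
    ∀ e' : Y.E, Y.p e' = x' → ∃! e : X.E, X.p e = x ∧ e' ∈ g e

/-- The identity morphism. -/
def SkewBooleanSpace.Hom.id (X : SkewBooleanSpace.{u}) : SkewBooleanSpace.Hom X X where
  g := PFun.id X.E
  h := PFun.id X.B
  proper_g := IsProperPartial.id
  proper_h := IsProperPartial.id
  comm e e' he := by
    rw [mem_pfun_id] at he ⊢
    rw [he]
  bijective_on_fibers x x' hx e' he' := by
    rw [mem_pfun_id] at hx
    refine ⟨e', ⟨he'.trans hx, mem_pfun_id.2 rfl⟩, ?_⟩
    rintro e ⟨-, he⟩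
    exact (mem_pfun_id.1 he).symm

/-- `f.comp k` is `f` followed by `k`, both components being composed as partial maps. -/
def SkewBooleanSpace.Hom.comp {X Y Z : SkewBooleanSpace.{u}} (f : SkewBooleanSpace.Hom X Y)
    (k : SkewBooleanSpace.Hom Y Z) : SkewBooleanSpace.Hom X Z where
  g := k.g.comp f.g
  h := k.h.comp f.h
  proper_g := k.proper_g.comp f.proper_g
  proper_h := k.proper_h.comp f.proper_h
  comm e e'' he := by
    obtain ⟨e', h1, h2⟩ := mem_pfun_comp.1 he
    exact mem_pfun_comp.2 ⟨_, f.comm _ _ h1, k.comm _ _ h2⟩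
  bijective_on_fibers x x'' hx e'' he'' := by
    obtain ⟨x', h1, h2⟩ := mem_pfun_comp.1 hx
    obtain ⟨e', ⟨he', hk⟩, huniq'⟩ := k.bijective_on_fibers x' x'' h2 e'' he''
    obtain ⟨e, ⟨he, hf⟩, huniq⟩ := f.bijective_on_fibers x x' h1 e' he'
    refine ⟨e, ⟨he, mem_pfun_comp.2 ⟨e', hf, hk⟩⟩, ?_⟩
    rintro d ⟨hd, hd'⟩
    obtain ⟨d', hd1, hd2⟩ := mem_pfun_comp.1 hd'
    have hd'x : Y.p d' = x' := by
      have := f.comm _ _ hd1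
      rw [hd] at this
      exact Part.mem_unique this h1
    have hde : d' = e' := huniq' d' ⟨hd'x, hd2⟩
    exact huniq d ⟨hd, hde ▸ hd1⟩

/-- A rectangular skew Boolean space: a skew Boolean space `p : E → B` with a continuous operation
`E ×_B E → E` over `B` that makes every fiber a rectangular band. -/
structure RectSkewBooleanSpace : Type (u + 1) extends SkewBooleanSpace.{u} where
  band : {q : E × E // p q.1 = p q.2} → E
  band_continuous : Continuous band
  band_over (x y : E) (hxy : p x = p y) : p (band ⟨(x, y), hxy⟩) = p x
  band_idem (x : E) : band ⟨(x, x), rfl⟩ = x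
  band_assoc (x y z : E) (hxy : p x = p y) (hyz : p y = p z) :
    band ⟨(band ⟨(x, y), hxy⟩, z), (band_over x y hxy).trans (hxy.trans hyz)⟩ =
      band ⟨(x, band ⟨(y, z), hyz⟩), hxy.trans (band_over y z hyz).symm⟩
  band_rect (x y z : E) (hxy : p x = p y) (hyz : p y = p z) :
    band ⟨(band ⟨(x, y), hxy⟩, z), (band_over x y hxy).trans (hxy.trans hyz)⟩ =
      band ⟨(x, z), hxy.trans hyz⟩

/-- A morphism of rectangular skew Boolean spaces: a morphism `(g, h)` of skew Boolean spaces whose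
domain `dom g` is closed under the band operation and for which `g` preserves the operation. (The
hypothesis `hxy'` is automatic, since `p' ∘ g = h ∘ p` on `dom g`.) -/
@[ext]
structure RectSkewBooleanSpace.Hom (X Y : RectSkewBooleanSpace.{u}) extends
    SkewBooleanSpace.Hom X.toSkewBooleanSpace Y.toSkewBooleanSpace where
  map_band (x y : X.E) (x' y' : Y.E) (hxy : X.p x = X.p y) (hxy' : Y.p x' = Y.p y') :
    x' ∈ g x → y' ∈ g y → Y.band ⟨(x', y'), hxy'⟩ ∈ g (X.band ⟨(x, y), hxy⟩)

/-- The category of rectangular skew Boolean spaces. -/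
instance : Category.{u} RectSkewBooleanSpace.{u} where
  Hom X Y := RectSkewBooleanSpace.Hom X Y
  id X :=
    { SkewBooleanSpace.Hom.id X.toSkewBooleanSpace with
      map_band := by
        intro x y x' y' hxy hxy' hx hy
        have hx := mem_pfun_id.1 hx
        have hy := mem_pfun_id.1 hy
        subst hx hy
        exact mem_pfun_id.2 rfl }
  comp {X Y Z} f k :=
    { SkewBooleanSpace.Hom.comp f.toHom k.toHom with
      map_band := by
        intro x y x'' y'' hxy hxy'' hx hy
        obtain ⟨x', hx1, hx2⟩ := mem_pfun_comp.1 hx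
        obtain ⟨y', hy1, hy2⟩ := mem_pfun_comp.1 hy
        have hxy' : Y.p x' = Y.p y' := by
          have h1 := f.comm _ _ hx1
          rw [hxy] at h1
          exact Part.mem_unique h1 (f.comm _ _ hy1)
        exact mem_pfun_comp.2 ⟨_, f.map_band x y x' y' hxy hxy' hx1 hy1,
          k.map_band x' y' x'' y'' hxy' hxy'' hx2 hy2⟩ }
  id_comp {X Y} f := by
    apply RectSkewBooleanSpace.Hom.ext
    · exact PFun.comp_id f.g
    · exact PFun.comp_id f.h
  comp_id {X Y} f := by
    apply RectSkewBooleanSpace.Hom.ext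
    · exact PFun.id_comp f.g
    · exact PFun.id_comp f.h
  assoc {W X Y Z} f k l := by
    apply RectSkewBooleanSpace.Hom.ext
    · exact (PFun.comp_assoc l.g k.g f.g).symm
    · exact (PFun.comp_assoc l.h k.h f.h).symm

end SkewDuality

/-!
The equivalence is given by the contravariant functor `sectionFunctor` that sends a rectangular skew
Boolean space `p : E → B` to the skew algebra of its compact open sections and a morphism `(g, h)`
to the inverse image map along `g`. It is shown to be faithful, full and essentially surjective.

A section is encoded by its image, a compact open subset of `E` on which `p` is injective. Meet is
the fiberwise band operation on the common domain, the join of two sections is the band product in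
the opposite order where both are defined, `\` restricts the domain, and `∩` is the intersection of
subsets of `E`, which is compact because `E` is Hausdorff. The identities hold because the values of
a section at the points of `B` lie in primitive algebras, rectangular bands with a zero adjoined
(`PrimitiveAlg`). Compact open sections form a basis of `E`, which gives faithfulness.

For fullness, a homomorphism `φ` from sections of `Y` to sections of `X` determines a partial map
`g` by `g e = e'` if and only if `e' ∈ S ↔ e ∈ φ S` for all sections `S`. Such an `e'` exists as
soon as `e` lies in some `φ S`: the `S` with `e ∈ φ S` are compact sets closed under finite
intersections and nonempty because `φ 0 = 0`, so they have a common point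
(`SkewAlgebraHom.exists_pointRel`). The remaining conditions on a morphism follow from the
preservation of the operations.

For essential surjectivity, the base space of an algebra `A` consists of its prime filters `P`, and
the fiber over `P` consists of the classes of elements of `P` under `a ∩ b ∈ P` (`germSpace`). Since
the natural partial order is compatible with the meet (`SkewAlgebra.NatLE.inf`), the meet descends
to germs; since `a ⊓ b ⊓ a ≤ a`, it makes each fiber a rectangular band. The map sending `a` to the
section of its germs is a homomorphism. It is injective because every nonzero element lies in a
prime filter (`PrimeFilter.exists_mem`), applied to `a \ (a ∩ b)`. It is surjective because a
compact open section is a finite union of basic ones and such a union is the section of the join.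
-/

namespace SkewDuality

/-! ### Identities in skew algebras -/

namespace SkewAlgebra

variable {A : Type u} [SkewAlgebra A]

theorem zero_inf (x : A) : 0 ⊓ x = 0 := by
  have h := inf_sup_absorb (0 : A) x
  rwa [zero_sup] at h

theorem inf_zero (x : A) : x ⊓ 0 = 0 := by
  have h := sup_inf_absorb_right (0 : A) x
  rwa [sup_zero] at h

theorem inf_eq_zero_symm {x y : A} (h : x ⊓ y = 0) : y ⊓ x = 0 := by
  rw [← inf_idem (y ⊓ x), inf_assoc, ← inf_assoc x, h, zero_inf, inf_zero]

/-- The natural partial order of a skew algebra. It is kept as a predicate, not an order instance,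
since the meet is not an infimum for it. -/
def NatLE (x y : A) : Prop := x ⊓ y = x ∧ y ⊓ x = x

theorem NatLE.refl (x : A) : NatLE x x := ⟨inf_idem x, inf_idem x⟩

theorem NatLE.trans {x y z : A} (h : NatLE x y) (k : NatLE y z) : NatLE x z :=
  ⟨by rw [← h.1, inf_assoc, k.1], by rw [← h.2, ← inf_assoc, k.2]⟩

theorem NatLE.antisymm {x y : A} (h : NatLE x y) (k : NatLE y x) : x = y :=
  h.1.symm.trans k.2

theorem inter_natLE_left (x y : A) : NatLE (x ∩ y) x := inter_le_left x y

theorem inter_natLE_right (x y : A) : NatLE (x ∩ y) y := inter_le_right x y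

theorem NatLE.inter {x y z : A} (h : NatLE z x) (k : NatLE z y) : NatLE z (x ∩ y) :=
  le_inter x y z h k

theorem inter_self (x : A) : x ∩ x = x :=
  (inter_natLE_left x x).antisymm ((NatLE.refl x).inter (NatLE.refl x))

theorem inter_comm (x y : A) : x ∩ y = y ∩ x :=
  ((inter_natLE_right x y).inter (inter_natLE_left x y)).antisymm
    ((inter_natLE_right y x).inter (inter_natLE_left y x))

theorem inf_inf_self_natLE (x y : A) : NatLE (x ⊓ y ⊓ x) x :=
  ⟨by rw [inf_assoc, inf_idem], by rw [← inf_assoc, ← inf_assoc, inf_idem]⟩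

/-- Elements with a common upper bound commute. Two-sided distributivity enters here: it gives
`u = u ⊓ (v ⊔ x) = (u ⊓ v) ⊔ u` and its mirror image, so that `u ⊓ v` and `v ⊓ u` both equal
`u ⊓ v ⊓ u`. -/
theorem NatLE.inf_comm {u v x : A} (hu : NatLE u x) (hv : NatLE v x) : u ⊓ v = v ⊓ u := by
  have h1 : v ⊔ x = x := by
    have h := inf_sup_absorb_right x v
    rwa [hv.1] at h
  have h2 : x ⊔ v = x := by
    have h := sup_inf_absorb x v
    rwa [hv.2] at h
  have h3 : (u ⊓ v) ⊔ u = u := by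
    have h := inf_sup_distrib_left u v x
    rw [h1, hu.1] at h
    exact h.symm
  have h4 : u ⊔ (v ⊓ u) = u := by
    have h := inf_sup_distrib_right u v x
    have h' := inf_sup_distrib_right u x v
    rw [h2, hu.2] at h'
    exact h'.symm
  have h5 := inf_sup_absorb (u ⊓ v) u
  rw [h3] at h5
  have h6 := sup_inf_absorb_right (v ⊓ u) u
  rw [h4, ← inf_assoc] at h6
  rw [← h5, h6]

/-- The meet is monotone in both arguments for the natural partial order. -/
theorem NatLE.inf {w a v b : A} (hw : NatLE w a) (hv : NatLE v b) : NatLE (w ⊓ v) (a ⊓ b) := by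
  -- a product one of whose outer factors lies below the other one lies itself below the larger of
  -- the two, so it commutes with every element below that one
  have e1 : w ⊓ v ⊓ a = w ⊓ v ⊓ w := by
    have h : NatLE (w ⊓ v ⊓ a) a :=
      ⟨by rw [inf_assoc, inf_idem], by rw [← inf_assoc, ← inf_assoc, hw.2]⟩
    have h' := hw.inf_comm h
    rwa [← inf_assoc, ← inf_assoc, inf_idem, inf_assoc (w ⊓ v), hw.2] at h'
  have e2 : v ⊓ w ⊓ b = v ⊓ w ⊓ v := by
    have h : NatLE (v ⊓ w ⊓ b) b :=
      ⟨by rw [inf_assoc, inf_idem], by rw [← inf_assoc, ← inf_assoc, hv.2]⟩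
    have h' := hv.inf_comm h
    rwa [← inf_assoc, ← inf_assoc, inf_idem, inf_assoc (v ⊓ w), hv.2] at h'
  have e3 : b ⊓ w ⊓ v = v ⊓ w ⊓ v := by
    have h : NatLE (b ⊓ w ⊓ v) b :=
      ⟨by rw [inf_assoc, hv.1], by rw [← inf_assoc, ← inf_assoc, inf_idem]⟩
    have h' := hv.inf_comm h
    rw [← inf_assoc, ← inf_assoc, hv.1, inf_assoc (b ⊓ w), inf_idem] at h'
    exact h'.symm
  have e4 : a ⊓ v ⊓ w = w ⊓ v ⊓ w := by
    have h : NatLE (a ⊓ v ⊓ w) a :=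
      ⟨by rw [inf_assoc, hw.1], by rw [← inf_assoc, ← inf_assoc, inf_idem]⟩
    have h' := hw.inf_comm h
    rw [← inf_assoc, ← inf_assoc, hw.1, inf_assoc (a ⊓ v), inf_idem] at h'
    exact h'.symm
  constructor
  · rw [← inf_assoc, e1, inf_assoc, inf_assoc, ← inf_assoc v, e2, ← inf_assoc, ← inf_assoc,
      inf_assoc, inf_idem]
  · rw [inf_assoc, ← inf_assoc b, e3, ← inf_assoc, ← inf_assoc, e4, inf_assoc, inf_idem]

theorem sdiff_natLE (x y : A) : NatLE (x \ y) x := by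
  have h := sdiff_inf x y
  have h' := inf_eq_zero_symm h
  have hs := sdiff_sup x y
  constructor
  · have k := inf_sup_absorb (x \ y) (x ⊓ y ⊓ x)
    rwa [hs] at k
  · have k := inf_sup_distrib_right (x \ y) (x \ y) (x ⊓ y ⊓ x)
    rwa [hs, h', inf_idem, sup_zero] at k

theorem sdiff_inf_right (x y : A) : x \ y ⊓ y = 0 := by
  have h := sdiff_inf x y
  -- `x \ y = x \ y ⊓ x`, so the square of `x \ y ⊓ y` contains `x \ y ⊓ (x ⊓ y ⊓ x)`
  have k := (sdiff_natLE x y).1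
  have k' := (sdiff_natLE x y).2
  have e₁ : x \ y ⊓ y = x \ y ⊓ (x ⊓ y) := by rw [← inf_assoc, k]
  have e₂ : x \ y ⊓ y = x ⊓ (x \ y ⊓ y) := by rw [← inf_assoc, k']
  calc x \ y ⊓ y = x \ y ⊓ (x ⊓ y) ⊓ (x ⊓ (x \ y ⊓ y)) := by rw [← e₁, ← e₂, inf_idem]
    _ = x \ y ⊓ (x ⊓ y ⊓ x) ⊓ (x \ y ⊓ y) := by simp only [inf_assoc]
    _ = 0 := by rw [h, zero_inf]

theorem inf_sdiff (x y : A) : y ⊓ x \ y = 0 :=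
  inf_eq_zero_symm (sdiff_inf_right x y)

theorem sdiff_natLE_sup_left (x y : A) : NatLE (x \ y) (x ⊔ y) := by
  constructor
  · rw [inf_sup_distrib_left, (sdiff_natLE x y).1, sdiff_inf_right, sup_zero]
  · rw [inf_sup_distrib_right, (sdiff_natLE x y).2, inf_sdiff, sup_zero]

theorem sdiff_natLE_sup_right (x y : A) : NatLE (x \ y) (y ⊔ x) := by
  constructor
  · rw [inf_sup_distrib_left, (sdiff_natLE x y).1, sdiff_inf_right, zero_sup]
  · rw [inf_sup_distrib_right, (sdiff_natLE x y).2, inf_sdiff, zero_sup]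

theorem inf_natLE_sup (x y : A) : NatLE (y ⊓ x) (x ⊔ y) := by
  constructor
  · rw [inf_sup_distrib_left, inf_assoc, inf_idem, sup_inf_absorb]
  · rw [inf_sup_distrib_right, ← inf_assoc, ← inf_assoc, inf_idem, inf_assoc,
      inf_sup_absorb_right]

theorem eq_of_sdiff_inter_eq_zero {a b : A} (h : a \ (a ∩ b) = 0) : a ∩ b = a := by
  have k := sdiff_sup a (a ∩ b)
  rwa [h, zero_sup, (inter_natLE_left a b).2, (inter_natLE_left a b).1] at k

end SkewAlgebra

/-! ### Prime filters -/

/-- A prime filter of a skew algebra: the inverse image of `1` under a nonzero map to the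
two-element lattice that preserves zero, meet and join. -/
@[ext]
structure PrimeFilter (A : Type u) [SkewAlgebra A] where
  carrier : Set A
  nonempty : carrier.Nonempty
  zero_notMem : (0 : A) ∉ carrier
  inf_mem_iff (a b : A) : a ⊓ b ∈ carrier ↔ a ∈ carrier ∧ b ∈ carrier
  sup_mem_iff (a b : A) : a ⊔ b ∈ carrier ↔ a ∈ carrier ∨ b ∈ carrier

open SkewAlgebra

namespace PrimeFilter

variable {A : Type u} [SkewAlgebra A]

theorem mem_of_natLE (P : PrimeFilter A) {a b : A} (h : NatLE a b) (ha : a ∈ P.carrier) :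
    b ∈ P.carrier := by
  rw [← h.1, P.inf_mem_iff] at ha
  exact ha.2

theorem sdiff_mem_iff (P : PrimeFilter A) (a b : A) :
    a \ b ∈ P.carrier ↔ a ∈ P.carrier ∧ b ∉ P.carrier := by
  constructor
  · intro h
    refine ⟨P.mem_of_natLE (sdiff_natLE a b) h, fun hb => P.zero_notMem ?_⟩
    rw [← sdiff_inf_right a b]
    exact (P.inf_mem_iff _ _).2 ⟨h, hb⟩
  · rintro ⟨ha, hb⟩
    rw [← sdiff_sup a b, P.sup_mem_iff] at ha
    refine ha.resolve_right fun h => hb ?_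
    exact ((P.inf_mem_iff _ _).1 ((P.inf_mem_iff _ _).1 h).1).2

/-- An ideal that does not contain `c`. -/
structure IsIdealAvoiding (c : A) (I : Set A) : Prop where
  zero_mem : (0 : A) ∈ I
  notMem : c ∉ I
  sup_mem_iff (a b : A) : a ⊔ b ∈ I ↔ a ∈ I ∧ b ∈ I
  inf_mem_left (a b : A) : a ∈ I → a ⊓ b ∈ I
  inf_mem_right (a b : A) : b ∈ I → a ⊓ b ∈ I

theorem IsIdealAvoiding.inf_symm {c : A} {I : Set A} (h : IsIdealAvoiding c I) {a b : A}
    (hab : a ⊓ b ∈ I) : b ⊓ a ∈ I := by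
  rw [← SkewAlgebra.inf_idem (b ⊓ a), SkewAlgebra.inf_assoc, ← SkewAlgebra.inf_assoc a]
  exact h.inf_mem_right _ _ (h.inf_mem_left _ _ hab)

/-- The residual of an ideal by `a` is an ideal. -/
theorem IsIdealAvoiding.residual {c : A} {I : Set A} (h : IsIdealAvoiding c I) {a : A}
    (hc : c ⊓ a ∉ I) : IsIdealAvoiding c {z | z ⊓ a ∈ I} where
  zero_mem := by
    rw [Set.mem_ofPred_eq, zero_inf]
    exact h.zero_mem
  notMem := hc
  sup_mem_iff x y := by
    simp only [Set.mem_ofPred_eq]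
    rw [inf_sup_distrib_right, h.sup_mem_iff]
  inf_mem_left x y hx := by
    rw [Set.mem_ofPred_eq, ← SkewAlgebra.inf_idem (x ⊓ y ⊓ a), SkewAlgebra.inf_assoc (x ⊓ y),
      SkewAlgebra.inf_assoc x y a, ← SkewAlgebra.inf_assoc a x]
    exact h.inf_mem_right _ _ (h.inf_mem_left _ _ (h.inf_symm hx))
  inf_mem_right x y hy := by
    rw [Set.mem_ofPred_eq, SkewAlgebra.inf_assoc]
    exact h.inf_mem_right _ _ hy

/-- Every nonzero element lies in a prime filter, namely the complement of an ideal that is maximal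
among those avoiding it. -/
theorem exists_mem {c : A} (hc : c ≠ 0) : ∃ P : PrimeFilter A, c ∈ P.carrier := by
  have h0 : IsIdealAvoiding c ({0} : Set A) :=
    { zero_mem := rfl
      notMem := hc
      sup_mem_iff := by
        intro a b
        simp only [Set.mem_singleton_iff]
        refine ⟨fun h => ⟨?_, ?_⟩, fun h => by rw [h.1, h.2, zero_sup]⟩
        · rw [← inf_sup_absorb a b, h, inf_zero]
        · rw [← sup_inf_absorb_right b a, h, zero_inf]
      inf_mem_left := by
        rintro a b rfl
        exact zero_inf b
      inf_mem_right := by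
        rintro a b rfl
        exact inf_zero a }
  obtain ⟨I, -, hI⟩ := zorn_subset_nonempty {I : Set A | IsIdealAvoiding c I} (by
    rintro C hC hchain ⟨J, hJ⟩
    refine ⟨⋃₀ C, ?_, fun s hs => Set.subset_sUnion_of_mem hs⟩
    exact
      { zero_mem := ⟨J, hJ, (hC hJ).zero_mem⟩
        notMem := by
          rintro ⟨K, hK, hcK⟩
          exact (hC hK).notMem hcK
        sup_mem_iff := by
          intro a b
          constructor
          · rintro ⟨K, hK, h⟩
            have h' := ((hC hK).sup_mem_iff a b).1 h
            exact ⟨⟨K, hK, h'.1⟩, ⟨K, hK, h'.2⟩⟩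
          · rintro ⟨⟨K, hK, ha⟩, ⟨M, hM, hb⟩⟩
            rcases hchain.total hK hM with hle | hle
            · exact ⟨M, hM, ((hC hM).sup_mem_iff a b).2 ⟨hle ha, hb⟩⟩
            · exact ⟨K, hK, ((hC hK).sup_mem_iff a b).2 ⟨ha, hle hb⟩⟩
        inf_mem_left := by
          rintro a b ⟨K, hK, h⟩
          exact ⟨K, hK, (hC hK).inf_mem_left a b h⟩
        inf_mem_right := by
          rintro a b ⟨K, hK, h⟩
          exact ⟨K, hK, (hC hK).inf_mem_right a b h⟩ }) {0} h0
  have hI' : IsIdealAvoiding c I := hI.prop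
  -- the residual of `I` by `a` is either improper or equal to `I`
  have key : ∀ a, c ⊓ a ∉ I → ∀ z, z ⊓ a ∈ I → z ∈ I := fun a ha z hz =>
    hI.le_of_ge (hI'.residual ha) (fun w hw => hI'.inf_mem_left w a hw) hz
  have prime : ∀ a b, a ⊓ b ∈ I → a ∈ I ∨ b ∈ I := by
    intro a b hab
    by_cases hcb : c ⊓ b ∈ I
    · exact Or.inr (key c (by rw [SkewAlgebra.inf_idem]; exact hI'.notMem) b (hI'.inf_symm hcb))
    · exact Or.inl (key b hcb a hab)
  refine ⟨⟨Iᶜ, ⟨c, hI'.notMem⟩, fun h => h hI'.zero_mem, fun a b => ?_, fun a b => ?_⟩,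
    hI'.notMem⟩
  · simp only [Set.mem_compl_iff, ← not_or]
    exact not_congr ⟨prime a b, fun h => h.elim (hI'.inf_mem_left a b) (hI'.inf_mem_right a b)⟩
  · simp only [Set.mem_compl_iff, hI'.sup_mem_iff a b, not_and_or]

/-! ### Germs -/

/-- Two elements have the same germ at the prime filter `P`. -/
def GermEq (P : PrimeFilter A) (a b : A) : Prop := a ∩ b ∈ P.carrier

theorem germEq_of_natLE {P : PrimeFilter A} {w a b : A} (hw : w ∈ P.carrier) (ha : NatLE w a)
    (hb : NatLE w b) : P.GermEq a b :=
  P.mem_of_natLE (ha.inter hb) hw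

theorem GermEq.right_mem {P : PrimeFilter A} {a b : A} (h : P.GermEq a b) : b ∈ P.carrier :=
  P.mem_of_natLE (inter_natLE_right a b) h

theorem GermEq.refl {P : PrimeFilter A} {a : A} (h : a ∈ P.carrier) : P.GermEq a a := by
  rwa [GermEq, inter_self]

theorem GermEq.symm {P : PrimeFilter A} {a b : A} (h : P.GermEq a b) : P.GermEq b a := by
  rwa [GermEq, inter_comm]

theorem GermEq.trans {P : PrimeFilter A} {a b c : A} (h : P.GermEq a b) (k : P.GermEq b c) :
    P.GermEq a c := by
  have hc : a ∩ b ⊓ b ∩ c = b ∩ c ⊓ a ∩ b :=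
    (inter_natLE_right a b).inf_comm (inter_natLE_left b c)
  refine germEq_of_natLE ((P.inf_mem_iff _ _).2 ⟨h, k⟩)
    (NatLE.trans ?_ (inter_natLE_left a b)) (NatLE.trans ?_ (inter_natLE_right b c))
  · exact ⟨by rw [hc, SkewAlgebra.inf_assoc, SkewAlgebra.inf_idem],
      by rw [← SkewAlgebra.inf_assoc, SkewAlgebra.inf_idem]⟩
  · exact ⟨by rw [SkewAlgebra.inf_assoc, SkewAlgebra.inf_idem],
      by rw [hc, ← SkewAlgebra.inf_assoc, SkewAlgebra.inf_idem]⟩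

theorem GermEq.inf {P : PrimeFilter A} {a b a' b' : A} (h : P.GermEq a a') (k : P.GermEq b b') :
    P.GermEq (a ⊓ b) (a' ⊓ b') :=
  germEq_of_natLE ((P.inf_mem_iff _ _).2 ⟨h, k⟩)
    ((inter_natLE_left a a').inf (inter_natLE_left b b'))
    ((inter_natLE_right a a').inf (inter_natLE_right b b'))

theorem germEq_inf_inf_self {P : PrimeFilter A} {a b : A} (ha : a ∈ P.carrier)
    (hb : b ∈ P.carrier) : P.GermEq (a ⊓ b ⊓ a) a :=
  germEq_of_natLE ((P.inf_mem_iff _ _).2 ⟨(P.inf_mem_iff _ _).2 ⟨ha, hb⟩, ha⟩)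
    (NatLE.refl _) (inf_inf_self_natLE a b)

/-- The fibers satisfy the rectangular identity: `x y x = x` holds there, and in a band it gives
`x y z = x y z x z = x z`. -/
theorem germEq_inf_inf {P : PrimeFilter A} {a b c : A} (ha : a ∈ P.carrier)
    (hb : b ∈ P.carrier) (hc : c ∈ P.carrier) : P.GermEq (a ⊓ b ⊓ c) (a ⊓ c) := by
  have hab := (P.inf_mem_iff a b).2 ⟨ha, hb⟩
  have h1 : P.GermEq (a ⊓ b ⊓ c) (a ⊓ b ⊓ (c ⊓ a ⊓ c)) :=
    (GermEq.refl hab).inf (germEq_inf_inf_self hc ha).symm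
  have h2 : P.GermEq (a ⊓ (b ⊓ c) ⊓ a ⊓ c) (a ⊓ c) :=
    (germEq_inf_inf_self ha ((P.inf_mem_iff b c).2 ⟨hb, hc⟩)).inf (GermEq.refl hc)
  refine h1.trans ?_
  simpa only [SkewAlgebra.inf_assoc] using h2

end PrimeFilter

/-- A germ of a skew algebra: a prime filter `P` together with an equivalence class, inside `P`, of
the relation of having the same germ at `P`. -/
@[ext]
structure Germ (A : Type u) [SkewAlgebra A] where
  base : PrimeFilter A
  carrier : Set A
  exists_eq : ∃ a ∈ base.carrier, carrier = {b | base.GermEq a b}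

namespace Germ

variable {A : Type u} [SkewAlgebra A]

/-- The germ of `a` at `P`. -/
def of (P : PrimeFilter A) (a : A) (ha : a ∈ P.carrier) : Germ A :=
  ⟨P, {b | P.GermEq a b}, a, ha, rfl⟩

theorem nonempty (e : Germ A) : e.carrier.Nonempty := by
  obtain ⟨a, ha, h⟩ := e.exists_eq
  exact ⟨a, h ▸ PrimeFilter.GermEq.refl ha⟩

theorem mem_base {e : Germ A} {a : A} (h : a ∈ e.carrier) : a ∈ e.base.carrier := by
  obtain ⟨b, hb, h'⟩ := e.exists_eq
  rw [h'] at h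
  exact PrimeFilter.GermEq.right_mem h

theorem mem_iff {e : Germ A} {a b : A} (h : a ∈ e.carrier) :
    b ∈ e.carrier ↔ e.base.GermEq a b := by
  obtain ⟨c, hc, h'⟩ := e.exists_eq
  rw [h'] at h ⊢
  exact ⟨fun k => (PrimeFilter.GermEq.symm h).trans k, fun k => PrimeFilter.GermEq.trans h k⟩

theorem ext_of_mem {e e' : Germ A} {a : A} (h : e.base = e'.base) (ha : a ∈ e.carrier)
    (ha' : a ∈ e'.carrier) : e = e' := by
  refine Germ.ext h (Set.ext fun b => ?_)
  rw [mem_iff ha, mem_iff ha', h]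

theorem mem_of_natLE {e : Germ A} {a b : A} (ha : a ∈ e.carrier) (h : NatLE b a)
    (hb : b ∈ e.base.carrier) : b ∈ e.carrier :=
  (mem_iff ha).2 (PrimeFilter.germEq_of_natLE hb h (NatLE.refl b))

theorem mem_of_natLE' {e : Germ A} {a b : A} (ha : a ∈ e.carrier) (h : NatLE a b) :
    b ∈ e.carrier :=
  (mem_iff ha).2 (PrimeFilter.germEq_of_natLE (mem_base ha) (NatLE.refl a) h)

theorem mem_of_self {P : PrimeFilter A} {a : A} (ha : a ∈ P.carrier) : a ∈ (of P a ha).carrier :=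
  PrimeFilter.GermEq.refl ha

/-- The meet of two germs at the same prime filter, computed on representatives. -/
noncomputable def mul (e e' : Germ A) (h : e.base = e'.base) : Germ A :=
  of e.base (e.nonempty.some ⊓ e'.nonempty.some) ((e.base.inf_mem_iff _ _).2
    ⟨mem_base e.nonempty.some_mem, h ▸ mem_base e'.nonempty.some_mem⟩)

theorem inf_mem_mul {e e' : Germ A} (h : e.base = e'.base) {a b : A} (ha : a ∈ e.carrier)
    (hb : b ∈ e'.carrier) : a ⊓ b ∈ (mul e e' h).carrier := by
  have k := (mem_iff e'.nonempty.some_mem).1 hb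
  rw [← h] at k
  exact ((mem_iff e.nonempty.some_mem).1 ha).inf k

theorem inf_mem_iff {e : Germ A} {a b : A} : a ⊓ b ∈ e.carrier ↔
    ∃ e₁ e₂ : Germ A, ∃ h : e₁.base = e₂.base, a ∈ e₁.carrier ∧ b ∈ e₂.carrier ∧
      mul e₁ e₂ h = e := by
  constructor
  · intro h
    obtain ⟨ha, hb⟩ := (e.base.inf_mem_iff a b).1 (mem_base h)
    exact ⟨of e.base a ha, of e.base b hb, rfl, mem_of_self ha, mem_of_self hb,
      ext_of_mem rfl (inf_mem_mul _ (mem_of_self ha) (mem_of_self hb)) h⟩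
  · rintro ⟨e₁, e₂, h, ha, hb, rfl⟩
    exact inf_mem_mul h ha hb

theorem sdiff_mem_iff {e : Germ A} {a b : A} : a \ b ∈ e.carrier ↔
    a ∈ e.carrier ∧ b ∉ e.base.carrier := by
  constructor
  · intro h
    exact ⟨mem_of_natLE' h (sdiff_natLE a b), ((e.base.sdiff_mem_iff a b).1 (mem_base h)).2⟩
  · rintro ⟨ha, hb⟩
    exact mem_of_natLE ha (sdiff_natLE a b) ((e.base.sdiff_mem_iff a b).2 ⟨mem_base ha, hb⟩)

theorem inter_mem_iff {e : Germ A} {a b : A} : a ∩ b ∈ e.carrier ↔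
    a ∈ e.carrier ∧ b ∈ e.carrier := by
  constructor
  · intro h
    exact ⟨mem_of_natLE' h (inter_natLE_left a b), mem_of_natLE' h (inter_natLE_right a b)⟩
  · rintro ⟨ha, hb⟩
    exact mem_of_natLE ha (inter_natLE_left a b) ((mem_iff ha).1 hb)

/-- Where both `a` and `b` are defined, the germ of `a ⊔ b` is that of `b ⊓ a`; where only one of
them is defined, it is the germ of that one. -/
theorem sup_mem_iff {e : Germ A} {a b : A} : a ⊔ b ∈ e.carrier ↔
    (a ∈ e.carrier ∧ b ∉ e.base.carrier) ∨ (b ∈ e.carrier ∧ a ∉ e.base.carrier) ∨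
      b ⊓ a ∈ e.carrier := by
  constructor
  · intro h
    by_cases ha : a ∈ e.base.carrier
    · by_cases hb : b ∈ e.base.carrier
      · exact Or.inr (Or.inr (mem_of_natLE h (inf_natLE_sup a b)
          ((e.base.inf_mem_iff b a).2 ⟨hb, ha⟩)))
      · have k := mem_of_natLE h (sdiff_natLE_sup_left a b) ((e.base.sdiff_mem_iff a b).2 ⟨ha, hb⟩)
        exact Or.inl (sdiff_mem_iff.1 k)
    · have hb := ((e.base.sup_mem_iff a b).1 (mem_base h)).resolve_left ha
      have k := mem_of_natLE h (sdiff_natLE_sup_right b a) ((e.base.sdiff_mem_iff b a).2 ⟨hb, ha⟩)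
      exact Or.inr (Or.inl (sdiff_mem_iff.1 k))
  · rintro (h | h | h)
    · exact mem_of_natLE' (sdiff_mem_iff.2 h) (sdiff_natLE_sup_left a b)
    · exact mem_of_natLE' (sdiff_mem_iff.2 h) (sdiff_natLE_sup_right b a)
    · exact mem_of_natLE' h (inf_natLE_sup a b)

theorem mul_self (e : Germ A) : mul e e rfl = e := by
  obtain ⟨a, ha⟩ := e.nonempty
  have h := inf_mem_mul (e := e) (e' := e) rfl ha ha
  rw [SkewAlgebra.inf_idem] at h
  exact ext_of_mem rfl h ha

theorem mul_assoc {x y z : Germ A} (hxy : x.base = y.base) (hyz : y.base = z.base) :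
    mul (mul x y hxy) z (hxy.trans hyz) = mul x (mul y z hyz) hxy := by
  obtain ⟨a, ha⟩ := x.nonempty
  obtain ⟨b, hb⟩ := y.nonempty
  obtain ⟨c, hc⟩ := z.nonempty
  refine ext_of_mem (a := a ⊓ b ⊓ c) rfl (inf_mem_mul _ (inf_mem_mul _ ha hb) hc) ?_
  rw [SkewAlgebra.inf_assoc]
  exact inf_mem_mul (e' := mul y z hyz) hxy ha (inf_mem_mul _ hb hc)

theorem mul_mul_eq {x y z : Germ A} (hxy : x.base = y.base) (hyz : y.base = z.base) :
    mul (mul x y hxy) z (hxy.trans hyz) = mul x z (hxy.trans hyz) := by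
  obtain ⟨a, ha⟩ := x.nonempty
  obtain ⟨b, hb⟩ := y.nonempty
  obtain ⟨c, hc⟩ := z.nonempty
  refine ext_of_mem (a := a ⊓ c) rfl ?_ (inf_mem_mul _ ha hc)
  refine (mem_iff (inf_mem_mul (e := mul x y hxy) _ (inf_mem_mul hxy ha hb) hc)).2 ?_
  change x.base.GermEq _ _
  refine PrimeFilter.germEq_inf_inf (mem_base ha) (?_ : b ∈ x.base.carrier)
    (?_ : c ∈ x.base.carrier)
  · rw [hxy]
    exact mem_base hb
  · rw [hxy, hyz]
    exact mem_base hc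

end Germ

/-! ### The space of germs -/

namespace PrimeFilter

variable {A : Type u} [SkewAlgebra A]

/-- The basic open set of prime filters containing `a`. -/
def basicOpen (a : A) : Set (PrimeFilter A) := {P | a ∈ P.carrier}

instance : TopologicalSpace (PrimeFilter A) := generateFrom (Set.range basicOpen)

theorem isTopologicalBasis : IsTopologicalBasis (Set.range (basicOpen (A := A))) where
  exists_subset_inter := by
    rintro _ ⟨a, rfl⟩ _ ⟨b, rfl⟩ P hP
    exact ⟨basicOpen (a ⊓ b), ⟨_, rfl⟩, (P.inf_mem_iff a b).2 hP,
      fun Q hQ => (Q.inf_mem_iff a b).1 hQ⟩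
  sUnion_eq := by
    refine Set.eq_univ_of_forall fun P => ?_
    obtain ⟨a, ha⟩ := P.nonempty
    exact ⟨_, ⟨a, rfl⟩, ha⟩
  eq_generateFrom := rfl

theorem isOpen_basicOpen (a : A) : IsOpen (basicOpen a) :=
  isTopologicalBasis.isOpen ⟨a, rfl⟩

/-- An ultrafilter `𝒰` on a basic open set converges to the prime filter of all `b` with
`basicOpen b ∈ 𝒰`. -/
theorem isCompact_basicOpen (a : A) : IsCompact (basicOpen a) := by
  rw [isCompact_iff_ultrafilter_le_nhds]
  intro U hU
  rw [Filter.le_principal_iff] at hU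
  have h0 : basicOpen (0 : A) = ∅ := Set.eq_empty_of_forall_notMem fun P hP => P.zero_notMem hP
  have hinf : ∀ b c : A, basicOpen (b ⊓ c) = basicOpen b ∩ basicOpen c := fun b c =>
    Set.ext fun P => P.inf_mem_iff b c
  have hsup : ∀ b c : A, basicOpen (b ⊔ c) = basicOpen b ∪ basicOpen c := fun b c =>
    Set.ext fun P => P.sup_mem_iff b c
  let P : PrimeFilter A :=
    { carrier := {b | basicOpen b ∈ U}
      nonempty := ⟨a, hU⟩
      zero_notMem := by
        rw [Set.mem_ofPred_eq, h0]
        exact U.empty_notMem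
      inf_mem_iff := by
        intro b c
        simp only [Set.mem_ofPred_eq]
        rw [hinf]
        exact Filter.inter_mem_iff
      sup_mem_iff := by
        intro b c
        simp only [Set.mem_ofPred_eq]
        rw [hsup]
        exact Ultrafilter.union_mem_iff }
  refine ⟨P, hU, ?_⟩
  rw [isTopologicalBasis.nhds_hasBasis.ge_iff]
  rintro _ ⟨⟨b, rfl⟩, hb⟩
  exact hb

instance : T2Space (PrimeFilter A) := by
  have key : ∀ P Q : PrimeFilter A, ∀ a ∈ P.carrier, a ∉ Q.carrier →
      ∃ u v : Set (PrimeFilter A), IsOpen u ∧ IsOpen v ∧ P ∈ u ∧ Q ∈ v ∧ Disjoint u v := by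
    intro P Q a ha hQ
    obtain ⟨b, hb⟩ := Q.nonempty
    refine ⟨basicOpen a, basicOpen (b \ a), isOpen_basicOpen _, isOpen_basicOpen _, ha,
      (Q.sdiff_mem_iff b a).2 ⟨hb, hQ⟩, Set.disjoint_left.2 fun R h1 h2 => ?_⟩
    exact ((R.sdiff_mem_iff b a).1 h2).2 h1
  refine ⟨fun P Q hne => ?_⟩
  by_cases h : P.carrier ⊆ Q.carrier
  · obtain ⟨a, haQ, haP⟩ := Set.not_subset.1 fun h' =>
      hne (PrimeFilter.ext (Set.Subset.antisymm h h'))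
    obtain ⟨u, v, hu, hv, h1, h2, h3⟩ := key Q P a haQ haP
    exact ⟨v, u, hv, hu, h2, h1, h3.symm⟩
  · obtain ⟨a, haP, haQ⟩ := Set.not_subset.1 h
    exact key P Q a haP haQ

end PrimeFilter

/-- A Hausdorff space with a basis of compact open sets is a Boolean space. -/
theorem BooleanSpace.of_basis {X : Type u} [TopologicalSpace X] [T2Space X] {s : Set (Set X)}
    (hs : IsTopologicalBasis s) (hc : ∀ u ∈ s, IsCompact u) : BooleanSpace X where
  t2 := inferInstance
  locallyCompact := by
    refine ⟨fun x n hn => ?_⟩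
    obtain ⟨u, hu, hxu, hun⟩ := hs.mem_nhds_iff.1 hn
    exact ⟨u, (hs.isOpen hu).mem_nhds hxu, hun, hc u hu⟩
  clopen_basis := by
    refine isTopologicalBasis_of_isOpen_of_nhds (fun u hu => hu.isOpen) fun x n hx hn => ?_
    obtain ⟨u, hu, hxu, hun⟩ := hs.exists_subset_of_mem_open hx hn
    exact ⟨u, ⟨(hc u hu).isClosed, hs.isOpen hu⟩, hxu, hun⟩

instance (A : Type u) [SkewAlgebra A] : BooleanSpace (PrimeFilter A) :=
  BooleanSpace.of_basis PrimeFilter.isTopologicalBasis (by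
    rintro _ ⟨a, rfl⟩
    exact PrimeFilter.isCompact_basicOpen a)

namespace Germ

variable {A : Type u} [SkewAlgebra A]

/-- The basic open set of germs of `a`. -/
def basicOpen (a : A) : Set (Germ A) := {e | a ∈ e.carrier}

instance : TopologicalSpace (Germ A) := generateFrom (Set.range basicOpen)

theorem isTopologicalBasis : IsTopologicalBasis (Set.range (basicOpen (A := A))) where
  exists_subset_inter := by
    rintro _ ⟨a, rfl⟩ _ ⟨b, rfl⟩ e he
    exact ⟨basicOpen (a ∩ b), ⟨_, rfl⟩, inter_mem_iff.2 he, fun f hf => inter_mem_iff.1 hf⟩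
  sUnion_eq := by
    refine Set.eq_univ_of_forall fun e => ?_
    obtain ⟨a, ha⟩ := e.nonempty
    exact ⟨_, ⟨a, rfl⟩, ha⟩
  eq_generateFrom := rfl

theorem isOpen_basicOpen (a : A) : IsOpen (basicOpen a) :=
  isTopologicalBasis.isOpen ⟨a, rfl⟩

theorem image_basicOpen (a : A) : base '' basicOpen a = PrimeFilter.basicOpen a := by
  ext P
  constructor
  · rintro ⟨e, he, rfl⟩
    exact mem_base he
  · intro h
    exact ⟨of P a h, mem_of_self h, rfl⟩

theorem injOn_basicOpen (a : A) : Set.InjOn base (basicOpen a) :=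
  fun _ he _ he' h => ext_of_mem h he he'

theorem continuous_base : Continuous (base (A := A)) := by
  rw [PrimeFilter.isTopologicalBasis.continuous_iff]
  rintro _ ⟨b, rfl⟩
  rw [isOpen_iff_forall_mem_open]
  intro e he
  obtain ⟨a, ha⟩ := e.nonempty
  have hb : b ∈ e.base.carrier := he
  refine ⟨basicOpen (a ⊓ b ⊓ a), fun f hf => ?_, isOpen_basicOpen _,
    mem_of_natLE ha (inf_inf_self_natLE a b) ?_⟩
  · have h := mem_base hf
    rw [f.base.inf_mem_iff, f.base.inf_mem_iff] at h
    exact h.1.2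
  · rw [e.base.inf_mem_iff, e.base.inf_mem_iff]
    exact ⟨⟨mem_base ha, hb⟩, mem_base ha⟩

theorem isOpenMap_base : IsOpenMap (base (A := A)) := by
  rw [isTopologicalBasis.isOpenMap_iff]
  rintro _ ⟨a, rfl⟩
  rw [image_basicOpen]
  exact PrimeFilter.isOpen_basicOpen a

theorem isOpenEmbedding_base (a : A) : Topology.IsOpenEmbedding ((basicOpen a).domRestrict base) :=
  Topology.IsOpenEmbedding.of_continuous_injective_isOpenMap
    (continuous_base.comp continuous_subtype_val) (injOn_basicOpen a).injective
    (isOpenMap_base.comp (isOpen_basicOpen a).isOpenMap_subtype_val)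

theorem isLocalHomeomorph_base : IsLocalHomeomorph (base (A := A)) := by
  rw [isLocalHomeomorph_iff_isOpenEmbedding_restrict]
  intro e
  obtain ⟨a, ha⟩ := e.nonempty
  exact ⟨basicOpen a, (isOpen_basicOpen a).mem_nhds ha, isOpenEmbedding_base a⟩

theorem isCompact_basicOpen (a : A) : IsCompact (basicOpen a) := by
  have h := (isOpenEmbedding_base a).isInducing.isCompact_iff (s := Set.univ)
  rw [Set.image_univ, Set.range_domRestrict, image_basicOpen] at h
  rw [isCompact_iff_isCompact_univ]
  exact h.2 (PrimeFilter.isCompact_basicOpen a)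

instance : T2Space (Germ A) := by
  refine ⟨fun e e' hne => ?_⟩
  by_cases h : e.base = e'.base
  · obtain ⟨a, ha⟩ := e.nonempty
    obtain ⟨b, hb⟩ := e'.nonempty
    have hab : a ∩ b ∉ e.base.carrier := fun hab =>
      hne (ext_of_mem h ((mem_iff ha).2 hab) hb)
    refine ⟨basicOpen (a \ (a ∩ b)), basicOpen (b \ (a ∩ b)), isOpen_basicOpen _,
      isOpen_basicOpen _, sdiff_mem_iff.2 ⟨ha, hab⟩, sdiff_mem_iff.2 ⟨hb, h ▸ hab⟩,
      Set.disjoint_left.2 fun f h1 h2 => ?_⟩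
    have h1' := sdiff_mem_iff.1 h1
    have h2' := sdiff_mem_iff.1 h2
    exact h1'.2 (mem_base (inter_mem_iff.2 ⟨h1'.1, h2'.1⟩))
  · obtain ⟨u, v, hu, hv, h1, h2, h3⟩ := t2_separation h
    exact ⟨_, _, hu.preimage continuous_base, hv.preimage continuous_base, h1, h2,
      h3.preimage _⟩

theorem continuous_mul :
    Continuous fun q : {q : Germ A × Germ A // q.1.base = q.2.base} => mul q.1.1 q.1.2 q.2 := by
  rw [isTopologicalBasis.continuous_iff]
  rintro _ ⟨c, rfl⟩
  rw [isOpen_iff_forall_mem_open]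
  rintro ⟨⟨e, e'⟩, h⟩ hc
  obtain ⟨a, ha⟩ := e.nonempty
  obtain ⟨b, hb⟩ := e'.nonempty
  have hw := (mem_iff (inf_mem_mul h ha hb)).1 hc
  refine ⟨{q | q.1.1 ∈ basicOpen a ∧ q.1.2 ∈ basicOpen b ∧
      q.1.1.base ∈ PrimeFilter.basicOpen ((a ⊓ b) ∩ c)}, ?_, ?_, ha, hb, hw⟩
  · rintro ⟨⟨f, f'⟩, k⟩ ⟨h1, h2, h3⟩
    exact (mem_iff (inf_mem_mul k h1 h2)).2 h3
  · have c1 : Continuous fun q : {q : Germ A × Germ A // q.1.base = q.2.base} => q.1.1 :=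
      continuous_fst.comp continuous_subtype_val
    have c2 : Continuous fun q : {q : Germ A × Germ A // q.1.base = q.2.base} => q.1.2 :=
      continuous_snd.comp continuous_subtype_val
    exact ((isOpen_basicOpen a).preimage c1).inter (((isOpen_basicOpen b).preimage c2).inter
      ((PrimeFilter.isOpen_basicOpen _).preimage (continuous_base.comp c1)))

end Germ

instance (A : Type u) [SkewAlgebra A] : BooleanSpace (Germ A) :=
  BooleanSpace.of_basis Germ.isTopologicalBasis (by
    rintro _ ⟨a, rfl⟩
    exact Germ.isCompact_basicOpen a)

/-- The rectangular skew Boolean space of germs of a skew algebra. -/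
noncomputable def germSpace (A : Type u) [SkewAlgebra A] : RectSkewBooleanSpace.{u} where
  E := Germ A
  B := PrimeFilter A
  p := Germ.base
  etale := Germ.isLocalHomeomorph_base
  surj P := by
    obtain ⟨a, ha⟩ := P.nonempty
    exact ⟨Germ.of P a ha, rfl⟩
  band q := Germ.mul q.1.1 q.1.2 q.2
  band_continuous := Germ.continuous_mul
  band_over _ _ _ := rfl
  band_idem := Germ.mul_self
  band_assoc _ _ _ hxy hyz := Germ.mul_assoc hxy hyz
  band_rect _ _ _ hxy hyz := Germ.mul_mul_eq hxy hyz

/-! ### Primitive skew algebras -/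

/-- A rectangular band. -/
class RectBand (R : Type u) extends Mul R where
  mul_self (x : R) : x * x = x
  mul_assoc (x y z : R) : x * y * z = x * (y * z)
  mul_mul_eq (x y z : R) : x * y * z = x * z

/-- A rectangular band with a zero adjoined. -/
inductive PrimitiveAlg (R : Type u) : Type u
  | zero : PrimitiveAlg R
  | of (x : R) : PrimitiveAlg R

namespace PrimitiveAlg

variable {R : Type u}

instance : Zero (PrimitiveAlg R) := ⟨zero⟩

instance [Mul R] : Min (PrimitiveAlg R) where
  min
    | of x, of y => of (x * y)
    | _, _ => zero

/-- On the nonzero elements the join is the meet in the opposite order, as the absorption laws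
require. -/
instance [Mul R] : Max (PrimitiveAlg R) where
  max
    | of x, of y => of (y * x)
    | zero, y => y
    | x, zero => x

instance : SDiff (PrimitiveAlg R) where
  sdiff
    | x, zero => x
    | _, of _ => zero

open Classical in
noncomputable instance : Inter (PrimitiveAlg R) := ⟨fun x y => if x = y then x else zero⟩

theorem inter_self (x : PrimitiveAlg R) : x ∩ x = x := if_pos rfl

theorem inter_of_ne {x y : PrimitiveAlg R} (h : x ≠ y) : x ∩ y = zero := if_neg h

section

variable [Mul R]

theorem of_inf_of (x y : R) : of x ⊓ of y = of (x * y) := rfl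
theorem zero_inf (x : PrimitiveAlg R) : zero ⊓ x = zero := rfl
theorem inf_zero (x : PrimitiveAlg R) : x ⊓ zero = zero := by cases x <;> rfl
theorem of_sup_of (x y : R) : of x ⊔ of y = of (y * x) := rfl
theorem zero_sup (x : PrimitiveAlg R) : zero ⊔ x = x := by cases x <;> rfl
theorem sup_zero (x : PrimitiveAlg R) : x ⊔ zero = x := by cases x <;> rfl

end

theorem sdiff_of (x : PrimitiveAlg R) (y : R) : x \ of y = zero := by cases x <;> rfl
theorem sdiff_zero (x : PrimitiveAlg R) : x \ zero = x := by cases x <;> rfl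

noncomputable instance [RectBand R] : SkewAlgebra (PrimitiveAlg R) where
  inf_idem x := by cases x <;> simp [zero_inf, of_inf_of, RectBand.mul_self]
  sup_idem x := by cases x <;> simp [zero_sup, of_sup_of, RectBand.mul_self]
  inf_assoc x y z := by
    cases x <;> cases y <;> cases z <;> simp [zero_inf, inf_zero, of_inf_of, RectBand.mul_assoc]
  sup_assoc x y z := by
    cases x <;> cases y <;> cases z <;> simp [zero_sup, sup_zero, of_sup_of, RectBand.mul_assoc]
  inf_sup_absorb x y := by
    cases x <;> cases y <;> simp [zero_inf, of_inf_of, sup_zero, of_sup_of,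
      ← RectBand.mul_assoc, RectBand.mul_mul_eq, RectBand.mul_self]
  sup_inf_absorb_right x y := by
    cases x <;> cases y <;> simp [inf_zero, of_inf_of, zero_sup, of_sup_of,
      RectBand.mul_mul_eq, RectBand.mul_self]
  sup_inf_absorb x y := by
    cases x <;> cases y <;> simp [zero_inf, inf_zero, of_inf_of, sup_zero, of_sup_of,
      RectBand.mul_mul_eq, RectBand.mul_self]
  inf_sup_absorb_right x y := by
    cases x <;> cases y <;> simp [zero_inf, inf_zero, of_inf_of, zero_sup, sup_zero, of_sup_of,
      ← RectBand.mul_assoc, RectBand.mul_mul_eq, RectBand.mul_self]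
  inf_sup_distrib_left x y z := by
    cases x <;> cases y <;> cases z <;> simp [zero_inf, inf_zero, of_inf_of, zero_sup, sup_zero,
      of_sup_of, ← RectBand.mul_assoc, RectBand.mul_mul_eq]
  inf_sup_distrib_right x y z := by
    cases x <;> cases y <;> cases z <;> simp [zero_inf, inf_zero, of_inf_of, zero_sup, sup_zero,
      of_sup_of, ← RectBand.mul_assoc, RectBand.mul_mul_eq]
  zero_sup := zero_sup
  sup_zero := sup_zero
  sdiff_inf x y := by
    cases x <;> cases y <;> simp [zero_inf, inf_zero, of_inf_of, sdiff_of, sdiff_zero] <;> rfl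
  sdiff_sup x y := by
    cases x <;> cases y <;> simp [zero_inf, inf_zero, of_inf_of, sdiff_of, sdiff_zero, zero_sup,
      sup_zero, RectBand.mul_mul_eq, RectBand.mul_self]
  inter_le_left x y := by
    by_cases h : x = y
    · subst h
      cases x <;> simp [inter_self, zero_inf, of_inf_of, RectBand.mul_self]
    · simp [inter_of_ne h, zero_inf, inf_zero]
  inter_le_right x y := by
    by_cases h : x = y
    · subst h
      cases x <;> simp [inter_self, zero_inf, of_inf_of, RectBand.mul_self]
    · simp [inter_of_ne h, zero_inf, inf_zero]
  le_inter x y z := by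
    rintro ⟨h1, h2⟩ ⟨h3, h4⟩
    cases z with
    | zero => exact ⟨zero_inf _, inf_zero _⟩
    | of c =>
      -- in a rectangular band the natural order is equality
      have key : ∀ w : PrimitiveAlg R, of c ⊓ w = of c → w ⊓ of c = of c → w = of c := by
        intro w hw hw'
        cases w with
        | zero => exact hw'
        | of d =>
          rw [of_inf_of, of.injEq] at hw hw'
          rw [← RectBand.mul_self d, ← RectBand.mul_mul_eq d c d, hw', hw]
      rw [key x h1 h2, key y h3 h4, inter_self]
      exact ⟨congrArg of (RectBand.mul_self c), congrArg of (RectBand.mul_self c)⟩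

end PrimitiveAlg

/-- An algebra that embeds, compatibly with the operations, into a product of skew algebras is a
skew algebra. -/
abbrev SkewAlgebra.ofFamily {A : Type u} [Min A] [Max A] [SDiff A] [Inter A] [Zero A]
    {ι : Type u} {Z : ι → Type u} [∀ i, SkewAlgebra (Z i)] (φ : ∀ i, A → Z i)
    (inj : ∀ a b, (∀ i, φ i a = φ i b) → a = b) (map_zero : ∀ i, φ i 0 = 0)
    (map_inf : ∀ i a b, φ i (a ⊓ b) = φ i a ⊓ φ i b)
    (map_sup : ∀ i a b, φ i (a ⊔ b) = φ i a ⊔ φ i b)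
    (map_sdiff : ∀ i a b, φ i (a \ b) = φ i a \ φ i b)
    (map_inter : ∀ i a b, φ i (a ∩ b) = φ i a ∩ φ i b) : SkewAlgebra A where
  inf_idem _ := inj _ _ fun i => by simp only [map_inf, SkewAlgebra.inf_idem]
  sup_idem _ := inj _ _ fun i => by simp only [map_sup, SkewAlgebra.sup_idem]
  inf_assoc _ _ _ := inj _ _ fun i => by simp only [map_inf, SkewAlgebra.inf_assoc]
  sup_assoc _ _ _ := inj _ _ fun i => by simp only [map_sup, SkewAlgebra.sup_assoc]
  inf_sup_absorb _ _ := inj _ _ fun i => by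
    simp only [map_inf, map_sup, SkewAlgebra.inf_sup_absorb]
  sup_inf_absorb_right _ _ := inj _ _ fun i => by
    simp only [map_inf, map_sup, SkewAlgebra.sup_inf_absorb_right]
  sup_inf_absorb _ _ := inj _ _ fun i => by
    simp only [map_inf, map_sup, SkewAlgebra.sup_inf_absorb]
  inf_sup_absorb_right _ _ := inj _ _ fun i => by
    simp only [map_inf, map_sup, SkewAlgebra.inf_sup_absorb_right]
  inf_sup_distrib_left _ _ _ := inj _ _ fun i => by
    simp only [map_inf, map_sup, SkewAlgebra.inf_sup_distrib_left]
  inf_sup_distrib_right _ _ _ := inj _ _ fun i => by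
    simp only [map_inf, map_sup, SkewAlgebra.inf_sup_distrib_right]
  zero_sup _ := inj _ _ fun i => by simp only [map_sup, map_zero, SkewAlgebra.zero_sup]
  sup_zero _ := inj _ _ fun i => by simp only [map_sup, map_zero, SkewAlgebra.sup_zero]
  sdiff_inf _ _ := inj _ _ fun i => by
    simp only [map_inf, map_sdiff, map_zero, SkewAlgebra.sdiff_inf]
  sdiff_sup _ _ := inj _ _ fun i => by
    simp only [map_inf, map_sup, map_sdiff, SkewAlgebra.sdiff_sup]
  inter_le_left x y :=
    ⟨inj _ _ fun i => by simp only [map_inf, map_inter, (SkewAlgebra.inter_le_left _ _).1],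
      inj _ _ fun i => by simp only [map_inf, map_inter, (SkewAlgebra.inter_le_left _ _).2]⟩
  inter_le_right x y :=
    ⟨inj _ _ fun i => by simp only [map_inf, map_inter, (SkewAlgebra.inter_le_right _ _).1],
      inj _ _ fun i => by simp only [map_inf, map_inter, (SkewAlgebra.inter_le_right _ _).2]⟩
  le_inter x y z h k := by
    have key := fun i => SkewAlgebra.le_inter (φ i x) (φ i y) (φ i z)
      ⟨by rw [← map_inf, h.1], by rw [← map_inf, h.2]⟩
      ⟨by rw [← map_inf, k.1], by rw [← map_inf, k.2]⟩
    exact ⟨inj _ _ fun i => by rw [map_inf, map_inter, (key i).1],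
      inj _ _ fun i => by rw [map_inf, map_inter, (key i).2]⟩

/-! ### Compact open sections -/

instance (X : Type u) [TopologicalSpace X] [BooleanSpace X] : T2Space X := BooleanSpace.t2

instance (X : Type u) [TopologicalSpace X] [BooleanSpace X] : LocallyCompactSpace X :=
  BooleanSpace.locallyCompact

/-- In a Boolean space, the compact open sets form a basis. -/
theorem BooleanSpace.exists_compact_open {X : Type u} [TopologicalSpace X] [BooleanSpace X]
    {U : Set X} (hU : IsOpen U) {x : X} (hx : x ∈ U) :
    ∃ C : Set X, IsCompact C ∧ IsOpen C ∧ x ∈ C ∧ C ⊆ U := by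
  obtain ⟨K, hK, hxK, hKU⟩ := exists_compact_subset hU hx
  obtain ⟨C, hC, hxC, hCK⟩ :=
    BooleanSpace.clopen_basis.exists_subset_of_mem_open hxK isOpen_interior
  have hCK' := hCK.trans interior_subset
  exact ⟨C, hK.of_isClosed_subset hC.isClosed hCK', hC.isOpen, hxC, hCK'.trans hKU⟩

namespace RectSkewBooleanSpace

variable {X : RectSkewBooleanSpace.{u}}

/-- The fiber of the structure map over a point of the base. -/
@[ext]
structure Fiber (X : RectSkewBooleanSpace.{u}) (x : X.B) : Type u where
  val : X.E
  p_val : X.p val = x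

instance (x : X.B) : RectBand (X.Fiber x) where
  mul a b := ⟨X.band ⟨(a.1, b.1), a.2.trans b.2.symm⟩, (X.band_over _ _ _).trans a.2⟩
  mul_self a := Fiber.ext (X.band_idem a.1)
  mul_assoc a b c :=
    Fiber.ext (X.band_assoc a.1 b.1 c.1 (a.2.trans b.2.symm) (b.2.trans c.2.symm))
  mul_mul_eq a b c :=
    Fiber.ext (X.band_rect a.1 b.1 c.1 (a.2.trans b.2.symm) (b.2.trans c.2.symm))

end RectSkewBooleanSpace

/-- A compact open section of a rectangular skew Boolean space, given by its image: a compact open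
set that meets every fiber in at most one point. -/
@[ext]
structure CompactSection (X : RectSkewBooleanSpace.{u}) : Type u where
  carrier : Set X.E
  isCompact : IsCompact carrier
  isOpen : IsOpen carrier
  injOn : Set.InjOn X.p carrier

namespace CompactSection

variable {X : RectSkewBooleanSpace.{u}}

theorem exists_mem_subset {U : Set X.E} (hU : IsOpen U) {e : X.E} (he : e ∈ U) :
    ∃ S : CompactSection X, e ∈ S.carrier ∧ S.carrier ⊆ U := by
  obtain ⟨φ, hφ, hp⟩ := X.etale e
  obtain ⟨C, hC, hCo, heC, hCU⟩ :=
    BooleanSpace.exists_compact_open (hU.inter φ.open_source) ⟨he, hφ⟩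
  refine ⟨⟨C, hC, hCo, ?_⟩, heC, hCU.trans Set.inter_subset_left⟩
  rw [hp]
  exact φ.injOn.mono (hCU.trans Set.inter_subset_right)

theorem exists_mem (e : X.E) : ∃ S : CompactSection X, e ∈ S.carrier := by
  obtain ⟨S, hS, -⟩ := exists_mem_subset isOpen_univ (Set.mem_univ e)
  exact ⟨S, hS⟩

theorem eq_of_forall_mem {e e' : X.E} (h : ∀ S : CompactSection X, e ∈ S.carrier → e' ∈ S.carrier) :
    e = e' := by
  by_contra hne
  obtain ⟨S, hS, hS'⟩ := exists_mem_subset (isOpen_compl_singleton (x := e')) hne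
  exact hS' (h S hS) rfl

theorem isTopologicalBasis : IsTopologicalBasis (Set.range (carrier (X := X))) := by
  refine isTopologicalBasis_of_isOpen_of_nhds ?_ fun e U he hU => ?_
  · rintro _ ⟨S, rfl⟩
    exact S.isOpen
  · obtain ⟨S, hS, hSU⟩ := exists_mem_subset hU he
    exact ⟨_, ⟨S, rfl⟩, hS, hSU⟩

/-- The domain of a section in the base. -/
def support (S : CompactSection X) : Set X.B := X.p '' S.carrier

theorem isCompact_support (S : CompactSection X) : IsCompact S.support :=
  S.isCompact.image X.etale.continuous

theorem isOpen_support (S : CompactSection X) : IsOpen S.support :=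
  X.etale.isOpenMap _ S.isOpen

theorem mem_support {S : CompactSection X} {e : X.E} (h : e ∈ S.carrier) : X.p e ∈ S.support :=
  ⟨e, h, rfl⟩

theorem isTopologicalBasis_support : IsTopologicalBasis (Set.range (support (X := X))) := by
  refine isTopologicalBasis_of_isOpen_of_nhds ?_ fun x U hx hU => ?_
  · rintro _ ⟨S, rfl⟩
    exact S.isOpen_support
  · obtain ⟨e, rfl⟩ := X.surj x
    obtain ⟨S, hS, hSU⟩ := exists_mem_subset (hU.preimage X.etale.continuous) hx
    exact ⟨_, ⟨S, rfl⟩, mem_support hS, Set.image_subset_iff.2 hSU⟩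

theorem eq_of_forall_mem_support {x x' : X.B}
    (h : ∀ S : CompactSection X, x ∈ S.support → x' ∈ S.support) : x = x' := by
  by_contra hne
  obtain ⟨_, ⟨S, rfl⟩, hS, hS'⟩ := isTopologicalBasis_support.exists_subset_of_mem_open
    (show x ∈ ({x'}ᶜ : Set X.B) from hne) isOpen_compl_singleton
  exact hS' (h S hS) rfl

/-- The products `s ⋏ t` of points `s ∈ S` and `t ∈ T` in a common fiber. -/
def bandImage (S T : CompactSection X) : Set X.E :=
  {e | ∃ s ∈ S.carrier, ∃ t ∈ T.carrier, ∃ h : X.p s = X.p t, X.band ⟨(s, t), h⟩ = e}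

theorem isCompact_bandImage (S T : CompactSection X) : IsCompact (bandImage S T) := by
  have hcl : IsClosed {q : X.E × X.E | X.p q.1 = X.p q.2} :=
    isClosed_eq (X.etale.continuous.comp continuous_fst) (X.etale.continuous.comp continuous_snd)
  have hc := (hcl.isClosedEmbedding_subtypeVal.isCompact_preimage
    (S.isCompact.prod T.isCompact)).image X.band_continuous
  convert hc using 1
  ext e
  constructor
  · rintro ⟨s, hs, t, ht, h, rfl⟩
    exact ⟨⟨(s, t), h⟩, ⟨hs, ht⟩, rfl⟩
  · rintro ⟨⟨⟨s, t⟩, h⟩, ⟨hs, ht⟩, rfl⟩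
    exact ⟨s, hs, t, ht, h, rfl⟩

theorem isOpen_bandImage (S T : CompactSection X) : IsOpen (bandImage S T) := by
  rw [isOpen_iff_mem_nhds]
  rintro _ ⟨s, hs, t, ht, h, rfl⟩
  -- `p` is injective on the open set `φ.source`; close to `(s, t)` the band product stays in it
  obtain ⟨φ, hφ, hp⟩ := X.etale (X.band ⟨(s, t), h⟩)
  obtain ⟨W, hW, hWV⟩ := isOpen_induced_iff.1 (φ.open_source.preimage X.band_continuous)
  have hst : (s, t) ∈ W := by
    have h' : (⟨(s, t), h⟩ : {q : X.E × X.E // X.p q.1 = X.p q.2}) ∈ Subtype.val ⁻¹' W := by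
      rw [hWV]
      exact hφ
    exact h'
  obtain ⟨u, v, hu, hv, hsu, htv, huv⟩ := isOpen_prod_iff.1 hW s t hst
  have hpo := X.etale.isOpenMap
  have hN : IsOpen (φ.source ∩ X.p ⁻¹' (X.p '' (S.carrier ∩ u) ∩ X.p '' (T.carrier ∩ v))) :=
    φ.open_source.inter (((hpo _ (S.isOpen.inter hu)).inter (hpo _ (T.isOpen.inter hv))).preimage
      X.etale.continuous)
  refine Filter.mem_of_superset (hN.mem_nhds ⟨hφ, ?_, ?_⟩) ?_
  · exact ⟨s, ⟨hs, hsu⟩, (X.band_over s t h).symm⟩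
  · exact ⟨t, ⟨ht, htv⟩, h.symm.trans (X.band_over s t h).symm⟩
  · rintro e ⟨heV, ⟨s', ⟨hs', hsu'⟩, hse⟩, ⟨t', ⟨ht', htv'⟩, hte⟩⟩
    refine ⟨s', hs', t', ht', hse.trans hte.symm, ?_⟩
    have hmem : (⟨(s', t'), hse.trans hte.symm⟩ : {q : X.E × X.E // X.p q.1 = X.p q.2}) ∈
        X.band ⁻¹' φ.source := by
      rw [← hWV]
      exact huv ⟨hsu', htv'⟩
    refine φ.injOn hmem heV ?_
    rw [← hp]
    exact (X.band_over _ _ _).trans hse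

theorem injOn_bandImage (S T : CompactSection X) : Set.InjOn X.p (bandImage S T) := by
  rintro _ ⟨s, hs, t, ht, h, rfl⟩ _ ⟨s', hs', t', ht', h', rfl⟩ he
  rw [X.band_over, X.band_over] at he
  obtain rfl := S.injOn hs hs' he
  obtain rfl := T.injOn ht ht' (h.symm.trans h')
  rfl

instance : Zero (CompactSection X) :=
  ⟨⟨∅, isCompact_empty, isOpen_empty, Set.injOn_empty _⟩⟩

instance : Min (CompactSection X) :=
  ⟨fun S T => ⟨bandImage S T, isCompact_bandImage S T, isOpen_bandImage S T,
    injOn_bandImage S T⟩⟩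

instance : Inter (CompactSection X) :=
  ⟨fun S T => ⟨S.carrier ∩ T.carrier, S.isCompact.inter T.isCompact, S.isOpen.inter T.isOpen,
    S.injOn.mono Set.inter_subset_left⟩⟩

instance : SDiff (CompactSection X) :=
  ⟨fun S T => ⟨S.carrier ∩ X.p ⁻¹' T.supportᶜ,
    S.isCompact.inter_right (T.isOpen_support.isClosed_compl.preimage X.etale.continuous),
    S.isOpen.inter (T.isCompact_support.isClosed.isOpen_compl.preimage X.etale.continuous),
    S.injOn.mono Set.inter_subset_left⟩⟩

theorem mem_inf {S T : CompactSection X} {e : X.E} : e ∈ (S ⊓ T).carrier ↔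
    ∃ s ∈ S.carrier, ∃ t ∈ T.carrier, ∃ h : X.p s = X.p t, X.band ⟨(s, t), h⟩ = e :=
  Iff.rfl

theorem mem_inter {S T : CompactSection X} {e : X.E} : e ∈ (S ∩ T).carrier ↔
    e ∈ S.carrier ∧ e ∈ T.carrier :=
  Iff.rfl

theorem mem_sdiff {S T : CompactSection X} {e : X.E} : e ∈ (S \ T).carrier ↔
    e ∈ S.carrier ∧ X.p e ∉ T.support :=
  Iff.rfl

theorem inf_support {S T : CompactSection X} {e : X.E} (he : e ∈ (S ⊓ T).carrier) :
    X.p e ∈ S.support ∧ X.p e ∈ T.support := by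
  obtain ⟨s, hs, t, ht, h, rfl⟩ := mem_inf.1 he
  rw [X.band_over]
  exact ⟨mem_support hs, h ▸ mem_support ht⟩

/-- The join of two sections is each of them where the other is undefined, and their meet in the
opposite order where both are defined. -/
instance : Max (CompactSection X) where
  max S T :=
    { carrier := (S \ T).carrier ∪ ((T \ S).carrier ∪ (T ⊓ S).carrier)
      isCompact := (S \ T).isCompact.union ((T \ S).isCompact.union (T ⊓ S).isCompact)
      isOpen := (S \ T).isOpen.union ((T \ S).isOpen.union (T ⊓ S).isOpen)
      injOn := by
        rintro e (he | he | he) f (hf | hf | hf) h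
        · exact (S \ T).injOn he hf h
        · exact absurd (h ▸ mem_support hf.1) he.2
        · exact absurd (h ▸ (inf_support hf).1) he.2
        · exact absurd (h ▸ mem_support hf.1) he.2
        · exact (T \ S).injOn he hf h
        · exact absurd (h ▸ (inf_support hf).2) he.2
        · exact absurd (h ▸ (inf_support he).1) hf.2
        · exact absurd (h ▸ (inf_support he).2) hf.2
        · exact (T ⊓ S).injOn he hf h }

theorem mem_sup {S T : CompactSection X} {e : X.E} : e ∈ (S ⊔ T).carrier ↔
    e ∈ (S \ T).carrier ∨ e ∈ (T \ S).carrier ∨ e ∈ (T ⊓ S).carrier :=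
  Iff.rfl

open Classical in
/-- The value of a section at a point of the base, zero outside its support. -/
noncomputable def value (x : X.B) (S : CompactSection X) : PrimitiveAlg (X.Fiber x) :=
  if h : ∃ a : X.Fiber x, a.1 ∈ S.carrier then .of h.choose else .zero

theorem value_eq_of {x : X.B} {S : CompactSection X} (a : X.Fiber x) (h : a.1 ∈ S.carrier) :
    S.value x = .of a := by
  have h' : ∃ a : X.Fiber x, a.1 ∈ S.carrier := ⟨a, h⟩
  rw [value, dif_pos h']
  exact congrArg _ (RectSkewBooleanSpace.Fiber.ext
    (S.injOn h'.choose_spec h (h'.choose.2.trans a.2.symm)))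

theorem value_eq_zero {x : X.B} {S : CompactSection X} (h : x ∉ S.support) :
    S.value x = .zero :=
  dif_neg fun ⟨a, ha⟩ => h ⟨a.1, ha, a.2⟩

theorem mem_of_value_eq {x : X.B} {S : CompactSection X} {a : X.Fiber x} (h : S.value x = .of a) :
    a.1 ∈ S.carrier := by
  by_cases h' : ∃ a : X.Fiber x, a.1 ∈ S.carrier
  · obtain ⟨b, hb⟩ := h'
    rw [value_eq_of b hb, PrimitiveAlg.of.injEq] at h
    exact h ▸ hb
  · rw [value, dif_neg h'] at h
    cases h

theorem ext_value {S T : CompactSection X} (h : ∀ x, S.value x = T.value x) : S = T := by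
  ext e
  constructor
  · intro he
    have k := value_eq_of (x := X.p e) ⟨e, rfl⟩ he
    rw [h] at k
    exact mem_of_value_eq k
  · intro he
    have k := value_eq_of (x := X.p e) ⟨e, rfl⟩ he
    rw [← h] at k
    exact mem_of_value_eq k

theorem value_inf (x : X.B) (S T : CompactSection X) :
    (S ⊓ T).value x = S.value x ⊓ T.value x := by
  by_cases hS : x ∈ S.support
  · by_cases hT : x ∈ T.support
    · obtain ⟨s, hs, hsx⟩ := hS
      obtain ⟨t, ht, htx⟩ := hT
      rw [value_eq_of ⟨s, hsx⟩ hs, value_eq_of ⟨t, htx⟩ ht, PrimitiveAlg.of_inf_of]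
      exact value_eq_of _ (mem_inf.2 ⟨s, hs, t, ht, _, rfl⟩)
    · rw [value_eq_zero hT, PrimitiveAlg.inf_zero]
      refine value_eq_zero ?_
      rintro ⟨e, he, rfl⟩
      exact hT (inf_support he).2
  · rw [value_eq_zero hS, PrimitiveAlg.zero_inf]
    refine value_eq_zero ?_
    rintro ⟨e, he, rfl⟩
    exact hS (inf_support he).1

theorem value_sdiff (x : X.B) (S T : CompactSection X) :
    (S \ T).value x = S.value x \ T.value x := by
  by_cases hT : x ∈ T.support
  · obtain ⟨t, ht, htx⟩ := hT
    rw [value_eq_of ⟨t, htx⟩ ht, PrimitiveAlg.sdiff_of]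
    refine value_eq_zero ?_
    rintro ⟨e, he, rfl⟩
    exact he.2 ⟨t, ht, htx⟩
  · rw [value_eq_zero hT, PrimitiveAlg.sdiff_zero]
    by_cases hS : x ∈ S.support
    · obtain ⟨s, hs, rfl⟩ := hS
      rw [value_eq_of ⟨s, rfl⟩ hs]
      exact value_eq_of _ (mem_sdiff.2 ⟨hs, hT⟩)
    · rw [value_eq_zero hS]
      refine value_eq_zero ?_
      rintro ⟨e, he, rfl⟩
      exact hS (mem_support he.1)

theorem value_sup (x : X.B) (S T : CompactSection X) :
    (S ⊔ T).value x = S.value x ⊔ T.value x := by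
  by_cases hS : x ∈ S.support
  · by_cases hT : x ∈ T.support
    · obtain ⟨s, hs, hsx⟩ := hS
      obtain ⟨t, ht, htx⟩ := hT
      rw [value_eq_of ⟨s, hsx⟩ hs, value_eq_of ⟨t, htx⟩ ht, PrimitiveAlg.of_sup_of]
      exact value_eq_of _ (mem_sup.2 (Or.inr (Or.inr (mem_inf.2 ⟨t, ht, s, hs, _, rfl⟩))))
    · rw [value_eq_zero hT, PrimitiveAlg.sup_zero]
      obtain ⟨s, hs, rfl⟩ := hS
      rw [value_eq_of ⟨s, rfl⟩ hs]
      exact value_eq_of _ (mem_sup.2 (Or.inl (mem_sdiff.2 ⟨hs, hT⟩)))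
  · rw [value_eq_zero hS, PrimitiveAlg.zero_sup]
    by_cases hT : x ∈ T.support
    · obtain ⟨t, ht, rfl⟩ := hT
      rw [value_eq_of ⟨t, rfl⟩ ht]
      exact value_eq_of _ (mem_sup.2 (Or.inr (Or.inl (mem_sdiff.2 ⟨ht, hS⟩))))
    · rw [value_eq_zero hT]
      refine value_eq_zero ?_
      rintro ⟨e, he | he | he, rfl⟩
      · exact hS (mem_support he.1)
      · exact hT (mem_support he.1)
      · exact hS (inf_support he).2

theorem value_inter (x : X.B) (S T : CompactSection X) :
    (S ∩ T).value x = S.value x ∩ T.value x := by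
  by_cases h : S.value x = T.value x
  · rw [h, PrimitiveAlg.inter_self]
    by_cases hT : x ∈ T.support
    · obtain ⟨t, ht, rfl⟩ := hT
      rw [value_eq_of ⟨t, rfl⟩ ht] at h ⊢
      exact value_eq_of _ (mem_inter.2 ⟨mem_of_value_eq h, ht⟩)
    · rw [value_eq_zero hT]
      refine value_eq_zero ?_
      rintro ⟨e, he, rfl⟩
      exact hT (mem_support he.2)
  · rw [PrimitiveAlg.inter_of_ne h]
    refine value_eq_zero ?_
    rintro ⟨e, he, rfl⟩
    exact h ((value_eq_of ⟨e, rfl⟩ he.1).trans (value_eq_of ⟨e, rfl⟩ he.2).symm)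

noncomputable instance : SkewAlgebra (CompactSection X) :=
  SkewAlgebra.ofFamily value (fun _ _ => ext_value) (fun _ => value_eq_zero fun ⟨_, h, _⟩ => h)
    value_inf value_sup value_sdiff value_inter

end CompactSection

/-! ### The functor of compact open sections -/

namespace RectSkewBooleanSpace.Hom

variable {X Y : RectSkewBooleanSpace.{u}} (f : RectSkewBooleanSpace.Hom X Y)

theorem p_eq_of_mem {e₁ e₂ : X.E} {e₁' e₂' : Y.E} (h₁ : e₁' ∈ f.g e₁) (h₂ : e₂' ∈ f.g e₂)
    (h : X.p e₁ = X.p e₂) : Y.p e₁' = Y.p e₂' := by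
  have k := f.comm _ _ h₁
  rw [h] at k
  exact Part.mem_unique k (f.comm _ _ h₂)

theorem eq_of_mem {e₁ e₂ : X.E} {e' : Y.E} (h₁ : e' ∈ f.g e₁) (h₂ : e' ∈ f.g e₂)
    (h : X.p e₁ = X.p e₂) : e₁ = e₂ :=
  (f.bijective_on_fibers _ _ (f.comm _ _ h₁) e' rfl).unique ⟨rfl, h₁⟩ ⟨h.symm, h₂⟩

/-- The inverse image of a compact open section. -/
def preimage (S : CompactSection Y) : CompactSection X where
  carrier := f.g.preimage S.carrier
  isCompact := f.proper_g.isCompact_preimage _ S.isCompact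
  isOpen := f.proper_g.pcontinuous _ S.isOpen
  injOn := by
    rintro e₁ ⟨e₁', hS₁, h₁⟩ e₂ ⟨e₂', hS₂, h₂⟩ h
    obtain rfl := S.injOn hS₁ hS₂ (f.p_eq_of_mem h₁ h₂ h)
    exact f.eq_of_mem h₁ h₂ h

theorem mem_preimage {S : CompactSection Y} {e : X.E} :
    e ∈ (f.preimage S).carrier ↔ ∃ e' ∈ S.carrier, e' ∈ f.g e :=
  Iff.rfl

theorem mem_support_preimage {S : CompactSection Y} {x : X.B} :
    x ∈ (f.preimage S).support ↔ ∃ x' ∈ S.support, x' ∈ f.h x := by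
  constructor
  · rintro ⟨e, ⟨e', he', h⟩, rfl⟩
    exact ⟨Y.p e', CompactSection.mem_support he', f.comm _ _ h⟩
  · rintro ⟨_, ⟨e', he', rfl⟩, h⟩
    obtain ⟨e, ⟨hx, he⟩, -⟩ := f.bijective_on_fibers x _ h e' rfl
    exact ⟨e, ⟨e', he', he⟩, hx⟩

theorem preimage_zero : f.preimage 0 = 0 :=
  CompactSection.ext (Set.eq_empty_of_forall_notMem fun _ ⟨_, h, _⟩ => h)

theorem preimage_inf (S T : CompactSection Y) :
    f.preimage (S ⊓ T) = f.preimage S ⊓ f.preimage T := by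
  ext e
  constructor
  · rintro ⟨e', ⟨s, hs, t, ht, h, rfl⟩, he⟩
    have hp := f.comm _ _ he
    obtain ⟨e₁, ⟨h₁, hs₁⟩, -⟩ := f.bijective_on_fibers _ _ hp s (Y.band_over s t h).symm
    obtain ⟨e₂, ⟨h₂, ht₂⟩, -⟩ :=
      f.bijective_on_fibers _ _ hp t (h.symm.trans (Y.band_over s t h).symm)
    refine ⟨e₁, ⟨s, hs, hs₁⟩, e₂, ⟨t, ht, ht₂⟩, h₁.trans h₂.symm, ?_⟩
    exact f.eq_of_mem (f.map_band _ _ _ _ (h₁.trans h₂.symm) h hs₁ ht₂) he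
      ((X.band_over _ _ _).trans h₁)
  · rintro ⟨e₁, ⟨s, hs, hs₁⟩, e₂, ⟨t, ht, ht₂⟩, h, rfl⟩
    have h' := f.p_eq_of_mem hs₁ ht₂ h
    exact ⟨_, ⟨s, hs, t, ht, h', rfl⟩, f.map_band _ _ _ _ h h' hs₁ ht₂⟩

theorem preimage_sdiff (S T : CompactSection Y) :
    f.preimage (S \ T) = f.preimage S \ f.preimage T := by
  ext e
  rw [CompactSection.mem_sdiff, mem_support_preimage]
  constructor
  · rintro ⟨e', ⟨hS, hT⟩, he⟩
    refine ⟨⟨e', hS, he⟩, ?_⟩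
    rintro ⟨x', hx', hx⟩
    exact hT (Part.mem_unique hx (f.comm _ _ he) ▸ hx')
  · rintro ⟨⟨e', hS, he⟩, h⟩
    exact ⟨e', ⟨hS, fun hT => h ⟨_, hT, f.comm _ _ he⟩⟩, he⟩

theorem preimage_inter (S T : CompactSection Y) :
    f.preimage (S ∩ T) = f.preimage S ∩ f.preimage T := by
  ext e
  constructor
  · rintro ⟨e', ⟨hS, hT⟩, he⟩
    exact ⟨⟨e', hS, he⟩, ⟨e', hT, he⟩⟩
  · rintro ⟨⟨e', hS, he⟩, ⟨e'', hT, he'⟩⟩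
    obtain rfl := Part.mem_unique he he'
    exact ⟨e', ⟨hS, hT⟩, he⟩

theorem preimage_sup (S T : CompactSection Y) :
    f.preimage (S ⊔ T) = f.preimage S ⊔ f.preimage T := by
  ext e
  rw [CompactSection.mem_sup, ← preimage_sdiff, ← preimage_sdiff, ← preimage_inf]
  constructor
  · rintro ⟨e', h | h | h, he⟩
    · exact Or.inl ⟨e', h, he⟩
    · exact Or.inr (Or.inl ⟨e', h, he⟩)
    · exact Or.inr (Or.inr ⟨e', h, he⟩)
  · rintro (⟨e', h, he⟩ | ⟨e', h, he⟩ | ⟨e', h, he⟩)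
    · exact ⟨e', Or.inl h, he⟩
    · exact ⟨e', Or.inr (Or.inl h), he⟩
    · exact ⟨e', Or.inr (Or.inr h), he⟩

/-- The homomorphism of skew algebras induced by a morphism of spaces. -/
def preimageHom : SkewAlgebraHom (CompactSection Y) (CompactSection X) where
  toFun := f.preimage
  map_zero := f.preimage_zero
  map_inf := f.preimage_inf
  map_sup := f.preimage_sup
  map_sdiff := f.preimage_sdiff
  map_inter := f.preimage_inter

end RectSkewBooleanSpace.Hom

/-- The contravariant functor sending a space to its algebra of compact open sections. -/
noncomputable def sectionFunctor : RectSkewBooleanSpace.{u} ⥤ SkewAlg.{u}ᵒᵖ where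
  obj X := Opposite.op ⟨CompactSection X⟩
  map {X Y} f :=
    Quiver.Hom.op (X := (⟨CompactSection Y⟩ : SkewAlg)) (Y := (⟨CompactSection X⟩ : SkewAlg))
      (RectSkewBooleanSpace.Hom.preimageHom f)
  map_id X := by
    refine congrArg Quiver.Hom.op (SkewAlgebraHom.ext (funext fun S => CompactSection.ext ?_))
    change (PFun.id X.E).preimage _ = _
    rw [← PFun.coe_id, PFun.coe_preimage]
    rfl
  map_comp f k := by
    refine congrArg Quiver.Hom.op (SkewAlgebraHom.ext (funext fun S => CompactSection.ext ?_))
    exact PFun.preimage_comp _ _ _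

/-! ### Faithfulness -/

theorem RectSkewBooleanSpace.Hom.g_le {X Y : RectSkewBooleanSpace.{u}}
    {f k : RectSkewBooleanSpace.Hom X Y} (h : ∀ S, f.preimage S = k.preimage S) {e : X.E} {e' : Y.E}
    (he : e' ∈ f.g e) : e' ∈ k.g e := by
  have key : ∀ S : CompactSection Y, e' ∈ S.carrier → ∃ e'' ∈ S.carrier, e'' ∈ k.g e := by
    intro S hS
    rw [← RectSkewBooleanSpace.Hom.mem_preimage, ← h]
    exact ⟨e', hS, he⟩
  obtain ⟨S, hS⟩ := CompactSection.exists_mem e'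
  obtain ⟨e'', -, he''⟩ := key S hS
  have : e' = e'' := CompactSection.eq_of_forall_mem fun T hT => by
    obtain ⟨d, hd, hd'⟩ := key T hT
    exact Part.mem_unique hd' he'' ▸ hd
  exact this ▸ he''

/-- The base component of a morphism is determined by the other one, because the fibers are
nonempty. -/
theorem RectSkewBooleanSpace.Hom.h_le {X Y : RectSkewBooleanSpace.{u}}
    {f k : RectSkewBooleanSpace.Hom X Y} (h : ∀ S, f.preimage S = k.preimage S) {x : X.B} {x' : Y.B}
    (hx : x' ∈ f.h x) : x' ∈ k.h x := by
  obtain ⟨e', rfl⟩ := Y.surj x'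
  obtain ⟨e, ⟨rfl, he⟩, -⟩ := f.bijective_on_fibers _ _ hx e' rfl
  exact k.comm _ _ (g_le h he)

instance : sectionFunctor.{u}.Faithful where
  map_injective {X Y} f k h := by
    have hfk : RectSkewBooleanSpace.Hom.preimageHom f = RectSkewBooleanSpace.Hom.preimageHom k :=
      congrArg Quiver.Hom.unop h
    have h' : ∀ S, RectSkewBooleanSpace.Hom.preimage f S = RectSkewBooleanSpace.Hom.preimage k S :=
      fun S => congrFun (congrArg SkewAlgebraHom.toFun hfk) S
    refine RectSkewBooleanSpace.Hom.ext ?_ ?_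
    · exact funext fun e => Part.ext fun e' => ⟨RectSkewBooleanSpace.Hom.g_le h',
        RectSkewBooleanSpace.Hom.g_le fun S => (h' S).symm⟩
    · exact funext fun e => Part.ext fun e' => ⟨RectSkewBooleanSpace.Hom.h_le h',
        RectSkewBooleanSpace.Hom.h_le fun S => (h' S).symm⟩

/-! ### Fullness -/

/-- The partial map with a given functional relation as its graph. -/
noncomputable def pfunOfRel {α β : Type u} (R : α → β → Prop) : α →. β :=
  fun a => ⟨∃ b, R a b, fun h => h.choose⟩

theorem mem_pfunOfRel {α β : Type u} {R : α → β → Prop} (hR : ∀ a b c, R a b → R a c → b = c)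
    {a : α} {b : β} : b ∈ pfunOfRel R a ↔ R a b := by
  constructor
  · rintro ⟨h, rfl⟩
    exact h.choose_spec
  · intro h
    exact ⟨⟨b, h⟩, hR _ _ _ (Exists.choose_spec ⟨b, h⟩) h⟩

/-- A partial map into a Hausdorff space is continuous and proper if the inverse images of basic
open sets are compact and open. -/
theorem IsProperPartial.of_basis {X Y : Type u} [TopologicalSpace X] [TopologicalSpace Y]
    [T2Space Y] {f : X →. Y} {s : Set (Set Y)} (hs : IsTopologicalBasis s)
    (hc : ∀ u ∈ s, IsCompact (f.preimage u)) (ho : ∀ u ∈ s, IsOpen (f.preimage u)) :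
    IsProperPartial f := by
  have hcont : PContinuous f := by
    intro U hU
    rw [isOpen_iff_forall_mem_open]
    rintro x ⟨y, hy, hxy⟩
    obtain ⟨u, hu, hyu, huU⟩ := hs.exists_subset_of_mem_open hy hU
    exact ⟨_, PFun.preimage_mono f huU, ho u hu, y, hyu, hxy⟩
  refine ⟨hcont, fun K hK => ?_⟩
  obtain ⟨D, hKD, hD, hDc⟩ : ∃ D, K ⊆ D ∧ IsOpen D ∧ IsCompact (f.preimage D) := by
    refine hK.induction_on (p := fun K => ∃ D, K ⊆ D ∧ IsOpen D ∧ IsCompact (f.preimage D))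
      ⟨∅, subset_rfl, isOpen_empty, ?_⟩ ?_ ?_ ?_
    · convert isCompact_empty
      exact Set.eq_empty_of_forall_notMem fun x ⟨y, hy, _⟩ => hy
    · rintro K L hKL ⟨D, hLD, hD⟩
      exact ⟨D, hKL.trans hLD, hD⟩
    · rintro K L ⟨D, hKD, hD, hDc⟩ ⟨D', hLD, hD', hDc'⟩
      refine ⟨D ∪ D', Set.union_subset_union hKD hLD, hD.union hD', ?_⟩
      rw [PFun.preimage_union]
      exact hDc.union hDc'
    · intro y _
      obtain ⟨u, hu, hyu, -⟩ := hs.exists_subset_of_mem_open (Set.mem_univ y) isOpen_univ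
      exact ⟨u, mem_nhdsWithin_of_mem_nhds ((hs.isOpen hu).mem_nhds hyu), u, subset_rfl,
        hs.isOpen hu, hc u hu⟩
  convert hDc.diff (hcont (D \ K) (hD.sdiff hK.isClosed)) using 1
  ext x
  constructor
  · rintro ⟨y, hy, hxy⟩
    refine ⟨⟨y, hKD hy, hxy⟩, ?_⟩
    rintro ⟨z, hz, hxz⟩
    exact hz.2 (Part.mem_unique hxy hxz ▸ hy)
  · rintro ⟨⟨y, hy, hxy⟩, h⟩
    by_contra hK'
    exact h ⟨y, ⟨hy, fun hyK => hK' ⟨y, hyK, hxy⟩⟩, hxy⟩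

namespace SkewAlgebraHom

variable {X Y : RectSkewBooleanSpace.{u}}
  (φ : SkewAlgebraHom (CompactSection Y) (CompactSection X))

/-- The graph of the partial map on total spaces dual to `φ`. -/
def PointRel (e : X.E) (e' : Y.E) : Prop :=
  ∀ S, e' ∈ S.carrier ↔ e ∈ (φ.toFun S).carrier

/-- The graph of the partial map on base spaces dual to `φ`. -/
def BaseRel (x : X.B) (x' : Y.B) : Prop :=
  ∀ S, x' ∈ S.support ↔ x ∈ (φ.toFun S).support

variable {φ}

theorem pointRel_unique (e : X.E) (a b : Y.E) (ha : φ.PointRel e a) (hb : φ.PointRel e b) :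
    a = b :=
  CompactSection.eq_of_forall_mem fun S hS => (hb S).2 ((ha S).1 hS)

theorem baseRel_unique (x : X.B) (a b : Y.B) (ha : φ.BaseRel x a) (hb : φ.BaseRel x b) :
    a = b :=
  CompactSection.eq_of_forall_mem_support fun S hS => (hb S).2 ((ha S).1 hS)

theorem notMem_support_inter {Z : RectSkewBooleanSpace.{u}} {S T : CompactSection Z} {e : Z.E}
    (hS : e ∈ S.carrier) (hT : e ∉ T.carrier) : Z.p e ∉ (S ∩ T).support := by
  rintro ⟨d, ⟨hdS, hdT⟩, hd⟩
  exact hT (S.injOn hdS hS hd ▸ hdT)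

/-- The sections `S` with `e ∈ φ S` form a filter of compact sets; the point dual to `e` lies in
their intersection. -/
theorem exists_pointRel {e : X.E} {S₀ : CompactSection Y} (he : e ∈ (φ.toFun S₀).carrier) :
    ∃ e', φ.PointRel e e' := by
  let I := {S : CompactSection Y // e ∈ (φ.toFun S).carrier}
  have : Nonempty I := ⟨⟨S₀, he⟩⟩
  have hne : (⋂ i : I, i.1.carrier).Nonempty := by
    refine IsCompact.nonempty_iInter_of_directed_nonempty_isCompact_isClosed
      (fun i : I => i.1.carrier) ?_ ?_ (fun i => i.1.isCompact) fun i => i.1.isCompact.isClosed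
    · intro i j
      refine ⟨⟨i.1 ∩ j.1, ?_⟩, Set.inter_subset_left, Set.inter_subset_right⟩
      rw [φ.map_inter]
      exact ⟨i.2, j.2⟩
    · rintro ⟨S, hS⟩
      by_contra h
      have h0 : S = 0 := CompactSection.ext (Set.not_nonempty_iff_eq_empty.1 h)
      rw [h0, φ.map_zero] at hS
      exact hS
  obtain ⟨e', he'⟩ := hne
  have hmem : ∀ S, e ∈ (φ.toFun S).carrier → e' ∈ S.carrier := fun S hS =>
    Set.mem_iInter.1 he' ⟨S, hS⟩
  refine ⟨e', fun S => ⟨fun hS => ?_, hmem S⟩⟩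
  by_contra hne
  have h1 : e' ∈ (S₀ \ (S₀ ∩ S)).carrier := by
    refine hmem _ ?_
    rw [φ.map_sdiff, φ.map_inter]
    exact ⟨he, notMem_support_inter he hne⟩
  exact h1.2 (CompactSection.mem_support ⟨hmem _ he, hS⟩)

/-- Applying `PointRel` to the differences `S₀ \ S`, where `S₀` passes through `e'`, tests whether
the base point lies in the support of `S`. -/
theorem PointRel.baseRel {e : X.E} {e' : Y.E} (h : φ.PointRel e e') :
    φ.BaseRel (X.p e) (Y.p e') := by
  intro S
  obtain ⟨S₀, h₀⟩ := CompactSection.exists_mem e'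
  have k := h (S₀ \ S)
  rw [φ.map_sdiff, CompactSection.mem_sdiff, CompactSection.mem_sdiff] at k
  have k₀ := (h S₀).1 h₀
  simpa only [h₀, k₀, true_and, not_iff_not] using k

/-- Points in the fiber over `x'` lift to the fiber over `x`. -/
theorem BaseRel.exists_pointRel {x : X.B} {x' : Y.B} (h : φ.BaseRel x x') {e' : Y.E}
    (he' : Y.p e' = x') : ∃ e, X.p e = x ∧ φ.PointRel e e' := by
  obtain ⟨S₀, h₀⟩ := CompactSection.exists_mem e'
  obtain ⟨e, he, hx⟩ := (h S₀).1 ⟨e', h₀, he'⟩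
  obtain ⟨e'', he''⟩ := SkewAlgebraHom.exists_pointRel he
  have hb := he''.baseRel
  rw [hx] at hb
  have hp : Y.p e'' = Y.p e' := (baseRel_unique _ _ _ hb h).trans he'.symm
  obtain rfl := S₀.injOn ((he'' S₀).2 he) h₀ hp
  exact ⟨e, hx, he''⟩

theorem PointRel.band {a b : X.E} {a' b' : Y.E} (ha : φ.PointRel a a') (hb : φ.PointRel b b')
    (h : X.p a = X.p b) (h' : Y.p a' = Y.p b') :
    φ.PointRel (X.band ⟨(a, b), h⟩) (Y.band ⟨(a', b'), h'⟩) := by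
  obtain ⟨S, hS⟩ := CompactSection.exists_mem a'
  obtain ⟨T, hT⟩ := CompactSection.exists_mem b'
  have hmem : X.band ⟨(a, b), h⟩ ∈ (φ.toFun (S ⊓ T)).carrier := by
    rw [φ.map_inf]
    exact ⟨a, (ha S).1 hS, b, (hb T).1 hT, h, rfl⟩
  obtain ⟨c, hc⟩ := exists_pointRel hmem
  have hcb := hc.baseRel
  rw [X.band_over] at hcb
  have hp : Y.p c = Y.p (Y.band ⟨(a', b'), h'⟩) :=
    (baseRel_unique _ _ _ hcb ha.baseRel).trans (Y.band_over _ _ _).symm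
  have heq : c = Y.band ⟨(a', b'), h'⟩ :=
    (S ⊓ T).injOn ((hc _).2 hmem) ⟨a', hS, b', hT, h', rfl⟩ hp
  exact heq ▸ hc

theorem preimage_pointRel (S : CompactSection Y) :
    (pfunOfRel φ.PointRel).preimage S.carrier = (φ.toFun S).carrier := by
  ext e
  constructor
  · rintro ⟨e', hS, he⟩
    exact ((mem_pfunOfRel pointRel_unique).1 he S).1 hS
  · intro h
    obtain ⟨e', he⟩ := exists_pointRel h
    exact ⟨e', (he S).2 h, (mem_pfunOfRel pointRel_unique).2 he⟩

theorem preimage_baseRel (S : CompactSection Y) :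
    (pfunOfRel φ.BaseRel).preimage S.support = (φ.toFun S).support := by
  ext x
  constructor
  · rintro ⟨x', hS, hx⟩
    exact ((mem_pfunOfRel baseRel_unique).1 hx S).1 hS
  · rintro ⟨e, he, rfl⟩
    obtain ⟨e', he'⟩ := exists_pointRel he
    exact ⟨Y.p e', CompactSection.mem_support ((he' S).2 he),
      (mem_pfunOfRel baseRel_unique).2 he'.baseRel⟩

/-- The morphism of spaces dual to a homomorphism between algebras of compact open sections. -/
noncomputable def dual (φ : SkewAlgebraHom (CompactSection Y) (CompactSection X)) :
    RectSkewBooleanSpace.Hom X Y where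
  g := pfunOfRel φ.PointRel
  h := pfunOfRel φ.BaseRel
  proper_g := by
    refine IsProperPartial.of_basis CompactSection.isTopologicalBasis ?_ ?_
    · rintro _ ⟨S, rfl⟩
      rw [preimage_pointRel]
      exact (φ.toFun S).isCompact
    · rintro _ ⟨S, rfl⟩
      rw [preimage_pointRel]
      exact (φ.toFun S).isOpen
  proper_h := by
    refine IsProperPartial.of_basis CompactSection.isTopologicalBasis_support ?_ ?_
    · rintro _ ⟨S, rfl⟩
      rw [preimage_baseRel]
      exact (φ.toFun S).isCompact_support
    · rintro _ ⟨S, rfl⟩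
      rw [preimage_baseRel]
      exact (φ.toFun S).isOpen_support
  comm e e' he :=
    (mem_pfunOfRel baseRel_unique).2 ((mem_pfunOfRel pointRel_unique).1 he).baseRel
  bijective_on_fibers x x' hx e' he' := by
    obtain ⟨e, hex, he⟩ := ((mem_pfunOfRel baseRel_unique).1 hx).exists_pointRel he'
    refine ⟨e, ⟨hex, (mem_pfunOfRel pointRel_unique).2 he⟩, ?_⟩
    rintro d ⟨hdx, hd⟩
    have hd := (mem_pfunOfRel pointRel_unique).1 hd
    obtain ⟨S, hS⟩ := CompactSection.exists_mem e'
    exact (φ.toFun S).injOn ((hd S).1 hS) ((he S).1 hS) (hdx.trans hex.symm)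
  map_band a b a' b' h h' ha hb :=
    (mem_pfunOfRel pointRel_unique).2 (((mem_pfunOfRel pointRel_unique).1 ha).band
      ((mem_pfunOfRel pointRel_unique).1 hb) h h')

end SkewAlgebraHom

instance : sectionFunctor.{u}.Full where
  map_surjective {X Y} k := by
    let φ : SkewAlgebraHom (CompactSection Y) (CompactSection X) := k.unop
    have h : RectSkewBooleanSpace.Hom.preimageHom φ.dual = φ :=
      SkewAlgebraHom.ext (funext fun S =>
        CompactSection.ext (SkewAlgebraHom.preimage_pointRel S))
    exact ⟨φ.dual, congrArg (fun ψ => Quiver.Hom.op (X := (⟨CompactSection Y⟩ : SkewAlg))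
      (Y := (⟨CompactSection X⟩ : SkewAlg)) ψ) h⟩

/-! ### Essential surjectivity -/

section

variable {A : Type u} [SkewAlgebra A]

/-- The section of the space of germs given by an element of the algebra. -/
def germSection (a : A) : CompactSection (germSpace A) where
  carrier := Germ.basicOpen a
  isCompact := Germ.isCompact_basicOpen a
  isOpen := Germ.isOpen_basicOpen a
  injOn := Germ.injOn_basicOpen a

theorem support_germSection (a : A) : (germSection a).support = PrimeFilter.basicOpen a :=
  Germ.image_basicOpen a

theorem germSection_zero : germSection (0 : A) = 0 :=
  CompactSection.ext (Set.eq_empty_of_forall_notMem fun e (he : 0 ∈ e.carrier) =>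
    e.base.zero_notMem (Germ.mem_base he))

theorem germSection_inf (a b : A) : germSection (a ⊓ b) = germSection a ⊓ germSection b := by
  refine CompactSection.ext (Set.ext fun e => ?_)
  refine Iff.trans Germ.inf_mem_iff ?_
  constructor
  · rintro ⟨e₁, e₂, h, h₁, h₂, he⟩
    exact ⟨e₁, h₁, e₂, h₂, h, he⟩
  · rintro ⟨e₁, h₁, e₂, h₂, h, he⟩
    exact ⟨e₁, e₂, h, h₁, h₂, he⟩

theorem germSection_sdiff (a b : A) : germSection (a \ b) = germSection a \ germSection b := by
  refine CompactSection.ext (Set.ext fun e => ?_)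
  rw [CompactSection.mem_sdiff, support_germSection]
  exact Germ.sdiff_mem_iff

theorem germSection_inter (a b : A) : germSection (a ∩ b) = germSection a ∩ germSection b :=
  CompactSection.ext (Set.ext fun _ => Germ.inter_mem_iff)

theorem germSection_sup (a b : A) : germSection (a ⊔ b) = germSection a ⊔ germSection b := by
  refine CompactSection.ext (Set.ext fun e => ?_)
  rw [CompactSection.mem_sup, ← germSection_inf, CompactSection.mem_sdiff,
    CompactSection.mem_sdiff, support_germSection, support_germSection]
  exact Germ.sup_mem_iff

theorem germSection_injective : Function.Injective (germSection (A := A)) := by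
  have key : ∀ a b : A, germSection a = germSection b → a ∩ b = a := by
    intro a b h
    refine SkewAlgebra.eq_of_sdiff_inter_eq_zero (by_contra fun hne => ?_)
    obtain ⟨P, hP⟩ := PrimeFilter.exists_mem hne
    have hP' := (P.sdiff_mem_iff _ _).1 hP
    have ha : Germ.of P a hP'.1 ∈ (germSection a).carrier := Germ.mem_of_self hP'.1
    have hb : Germ.of P a hP'.1 ∈ (germSection b).carrier := h ▸ ha
    exact hP'.2 hb
  intro a b h
  rw [← key a b h, SkewAlgebra.inter_comm, key b a h.symm]

/-- The union of two basic sections that are contained in a common section is the section of the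
join: the two agree wherever both are defined. -/
theorem basicOpen_sup {a b : A} {S : Set (Germ A)} (hS : Set.InjOn Germ.base S)
    (ha : Germ.basicOpen a ⊆ S) (hb : Germ.basicOpen b ⊆ S) :
    Germ.basicOpen (a ⊔ b) = Germ.basicOpen a ∪ Germ.basicOpen b := by
  have key : ∀ {e f : Germ A}, a ∈ e.carrier → b ∈ f.carrier → e.base = f.base → e = f :=
    fun he hf h => hS (ha he) (hb hf) h
  have mul_mem : ∀ {e : Germ A}, a ∈ e.carrier → b ∈ e.carrier → b ⊓ a ∈ e.carrier :=
    fun {e} hea heb => Germ.inf_mem_iff.2 ⟨e, e, rfl, heb, hea, Germ.mul_self e⟩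
  ext e
  refine Iff.trans Germ.sup_mem_iff ?_
  constructor
  · rintro (h | h | h)
    · exact Or.inl h.1
    · exact Or.inr h.1
    · obtain ⟨e₁, e₂, k, h₁, h₂, rfl⟩ := Germ.inf_mem_iff.1 h
      obtain rfl := key h₂ h₁ k.symm
      rw [Germ.mul_self]
      exact Or.inl h₂
  · rintro (h | h)
    · by_cases hbe : b ∈ e.base.carrier
      · have hf := Germ.mem_of_self hbe
        exact Or.inr (Or.inr (mul_mem h ((key h hf rfl).symm ▸ hf)))
      · exact Or.inl ⟨h, hbe⟩
    · by_cases hae : a ∈ e.base.carrier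
      · have hf := Germ.mem_of_self hae
        exact Or.inr (Or.inr (mul_mem (key hf h rfl ▸ hf) h))
      · exact Or.inr (Or.inl ⟨h, hae⟩)

theorem germSection_surjective : Function.Surjective (germSection (A := A)) := by
  intro S
  obtain ⟨a, hle, ha⟩ : ∃ a : A, S.carrier ⊆ Germ.basicOpen a ∧ Germ.basicOpen a ⊆ S.carrier := by
    refine S.isCompact.induction_on
      (p := fun K => ∃ a : A, K ⊆ Germ.basicOpen a ∧ Germ.basicOpen a ⊆ S.carrier) ?_ ?_ ?_ ?_
    · refine ⟨0, Set.empty_subset _, fun e (he : 0 ∈ e.carrier) => ?_⟩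
      exact absurd (Germ.mem_base he) e.base.zero_notMem
    · rintro K L hKL ⟨a, hL, ha⟩
      exact ⟨a, hKL.trans hL, ha⟩
    · rintro K L ⟨a, hK, ha⟩ ⟨b, hL, hb⟩
      refine ⟨a ⊔ b, ?_, ?_⟩ <;> rw [basicOpen_sup S.injOn ha hb]
      · exact Set.union_subset_union hK hL
      · exact Set.union_subset ha hb
    · intro e he
      obtain ⟨_, ⟨a, rfl⟩, hea, ha⟩ :=
        Germ.isTopologicalBasis.exists_subset_of_mem_open he S.isOpen
      exact ⟨_, mem_nhdsWithin_of_mem_nhds ((Germ.isOpen_basicOpen a).mem_nhds hea), a,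
        subset_rfl, ha⟩
  exact ⟨a, CompactSection.ext (Set.Subset.antisymm ha hle)⟩

/-- The homomorphism sending an element of an algebra to the section of its germs. -/
def germHom (A : Type u) [SkewAlgebra A] :
    SkewAlgebraHom A (CompactSection (germSpace A)) where
  toFun := germSection
  map_zero := germSection_zero
  map_inf := germSection_inf
  map_sup := germSection_sup
  map_sdiff := germSection_sdiff
  map_inter := germSection_inter

end

/-- The inverse of a bijective homomorphism. -/
noncomputable def SkewAlgebraHom.inverse {A B : Type u} [SkewAlgebra A] [SkewAlgebra B]
    (f : SkewAlgebraHom A B) (hf : Function.Bijective f.toFun) : SkewAlgebraHom B A where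
  toFun := Function.surjInv hf.2
  map_zero := hf.1 (by rw [Function.surjInv_eq hf.2, f.map_zero])
  map_inf x y := hf.1 (by simp only [Function.surjInv_eq hf.2, f.map_inf])
  map_sup x y := hf.1 (by simp only [Function.surjInv_eq hf.2, f.map_sup])
  map_sdiff x y := hf.1 (by simp only [Function.surjInv_eq hf.2, f.map_sdiff])
  map_inter x y := hf.1 (by simp only [Function.surjInv_eq hf.2, f.map_inter])

/-- A bijective homomorphism is an isomorphism. -/
noncomputable def SkewAlg.isoOfBijective {A B : SkewAlg.{u}} (f : A ⟶ B)
    (hf : Function.Bijective (SkewAlgebraHom.toFun f)) : A ≅ B where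
  hom := f
  inv := SkewAlgebraHom.inverse f hf
  hom_inv_id := SkewAlgebraHom.ext (funext fun x => Function.leftInverse_surjInv hf x)
  inv_hom_id := SkewAlgebraHom.ext (funext fun x => Function.surjInv_eq hf.2 x)

instance : sectionFunctor.{u}.EssSurj where
  mem_essImage A :=
    ⟨germSpace A.unop.carrier, ⟨(SkewAlg.isoOfBijective (A := A.unop)
      (B := ⟨CompactSection (germSpace A.unop.carrier)⟩) (germHom A.unop.carrier)
      ⟨germSection_injective, germSection_surjective⟩).op⟩⟩

end SkewDuality

theorem mainTheorem2 :
    Nonempty (SkewDuality.SkewAlg.{u}ᵒᵖ ≌ SkewDuality.RectSkewBooleanSpace.{u}) := by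
  have : SkewDuality.sectionFunctor.{u}.IsEquivalence := {}
  exact ⟨SkewDuality.sectionFunctor.asEquivalence.symm⟩
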